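/- Let $\mathbb{N}=\{1,2,\ldots\}$ and, for $n\in\mathbb{N}$, let $X_n=\{1,\ldots,n\}\times\mathbb{N}$; the sets $\{i\}\times\mathbb{N}$ are its rays. Permutations act on the right. The Houghton group $H_n\le\mathrm{Sym}(X_n)$ consists of the permutations $g$ such that for every $i$ there is an integer $t_i(g)$ with $(i,m)g=(i,m+t_i(g))$ for all sufficiently large $m$. Let $S_n$ act on $X_n$ by permuting the rays, $(i,m)\sigma=(i\sigma,m)$; it normalises $H_n$, and $H_n\rtimes S_n$ denotes the resulting subgroup of $\mathrm{Sym}(X_n)$. Let $\mathrm{FSym}(X)$ be the group of permutations of $X$ with finite support and $\mathrm{FAlt}(X)$ its subgroup of even permutations. For $2\le i\le n$ let $g_i\in H_n$ be given by $(1,m)g_i=(1,m+1)$, $(i,1)g_i=(1,1)$, $(i,m)g_i=(i,m-1)$ for $m>1$, and $(j,m)g_i=(j,m)$ for $j\ne 1,i$. For $p\in\mathbb{N}$ put $U_p=\langle \mathrm{FAlt}(X_n),\,g_2^p,\ldots,g_n^p\rangle$. Let $n\ge 2$ and let $U$ be a subgroup of finite index in $H_n$. (1) There is an $m\in\mathbb{N}$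 such that $U_m\le U$, $N_{\mathrm{Sym}(X_n)}(U)\le N_{\mathrm{Sym}(X_n)}(U_m)$, and $U_m$ is characteristic in $U$. (2) For every $i$ some $u\in U$ has $t_i(u)>0$, so $T_i=\min\{t_i(u)\mid u\in U,\ t_i(u)>0\}$ is defined. Let $T=T_1+\cdots+T_n$, let $\phi\colon X_n\to X_T$ be the bijection which, for $1\le i\le n$ and $1\le d\le T_i$, sends the points $(i,d),(i,d+T_i),(i,d+2T_i),\ldots$ in this order to the points of the ray with number $T_1+\cdots+T_{i-1}+d$, and let $\hat\phi\colon\mathrm{Sym}(X_n)\to\mathrm{Sym}(X_T)$ be the isomorphism induced by $\phi$. Then \[(N_{\mathrm{Sym}(X_n)}(U))\hat\phi\le H_T\rtimes S_T .\] If $n=2$ or $\mathrm{FSym}(X_n)\le U$, then moreover $H_T\le (N_{\mathrm{Sym}(X_n)}(U))\hat\phi$. For every $U$, the group $(N_{\mathrm{Sym}(X_n)}(U))\hat\phi$ contains all $h\in H_T$ for which $t_1(h),\ldots,t_T(h)$ are all even. -/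

import Mathlib

namespace Houghton

/-- The set `X_n`: `n` disjoint rays, each a copy of the natural numbers. Rays and points are
numbered from `0`, so the `m`-th point of the `i`-th ray is `(i - 1, m - 1)`. -/
abbrev X (n : ℕ) : Type := Fin n × ℕ

/-- Far out on the `i`-th ray, `g` is the translation by `t`: that is, `t = t_i(g)`. -/
def EventualTranslation {n : ℕ} (g : Equiv.Perm (X n)) (i : Fin n) (t : ℤ) : Prop :=
  ∃ z : ℕ, ∀ m : ℕ, z ≤ m → (g (i, m)).1 = i ∧ ((g (i, m)).2 : ℤ) = m + t

theorem EventualTranslation.one {n : ℕ} (i : Fin n) :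
    EventualTranslation (1 : Equiv.Perm (X n)) i 0 :=
  ⟨0, fun m _ => by simp⟩

theorem EventualTranslation.mul {n : ℕ} {g h : Equiv.Perm (X n)} {i : Fin n} {s t : ℤ}
    (hg : EventualTranslation g i s) (hh : EventualTranslation h i t) :
    EventualTranslation (g * h) i (s + t) := by
  obtain ⟨z, hz⟩ := hg
  obtain ⟨w, hw⟩ := hh
  refine ⟨w + z + t.natAbs, fun m hm => ?_⟩
  obtain ⟨h1, h2⟩ := hw m (by omega)
  have e : h (i, m) = (i, (h (i, m)).2) := Prod.ext h1 rfl
  obtain ⟨h3, h4⟩ := hz (h (i, m)).2 (by omega)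
  rw [Equiv.Perm.mul_apply, e]
  exact ⟨h3, by omega⟩

theorem EventualTranslation.inv {n : ℕ} {g : Equiv.Perm (X n)} {i : Fin n} {t : ℤ}
    (hg : EventualTranslation g i t) : EventualTranslation g⁻¹ i (-t) := by
  obtain ⟨z, hz⟩ := hg
  refine ⟨z + t.natAbs, fun m hm => ?_⟩
  obtain ⟨h1, h2⟩ := hz (m - t).toNat (by omega)
  have e : g⁻¹ (i, m) = (i, (m - t).toNat) := by
    rw [Equiv.Perm.inv_eq_iff_eq]
    refine Prod.ext h1.symm ?_
    have h3 : ((g (i, (m - t).toNat)).2 : ℤ) = m := by omega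
    exact_mod_cast h3.symm
  rw [e]
  refine ⟨rfl, ?_⟩
  simp only
  omega

/-- The Houghton group `H_n`: the permutations of `X_n` that are eventually a translation on
each ray. -/
def H (n : ℕ) : Subgroup (Equiv.Perm (X n)) where
  carrier := {g | ∀ i, ∃ t : ℤ, EventualTranslation g i t}
  one_mem' i := ⟨0, .one i⟩
  mul_mem' hg hh i :=
    let ⟨s, hs⟩ := hg i
    let ⟨t, ht⟩ := hh i
    ⟨s + t, hs.mul ht⟩
  inv_mem' hg i :=
    let ⟨t, ht⟩ := hg i
    ⟨-t, ht.inv⟩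

/-- The finitary symmetric group `FSym(α)`: the permutations of finite support. -/
def FSym (α : Type*) : Subgroup (Equiv.Perm α) where
  carrier := {g | {x | g x ≠ x}.Finite}
  one_mem' := by simp
  mul_mem' {g h} hg hh := by
    refine (hg.union hh).subset fun x hx => ?_
    by_contra hc
    simp only [Set.mem_union, Set.mem_ofPred_eq, not_or, not_not] at hc
    exact hx (by rw [Equiv.Perm.mul_apply, hc.2, hc.1])
  inv_mem' {g} hg := by
    refine Set.Finite.subset hg fun x hx hc => hx ?_
    rw [Equiv.Perm.inv_eq_iff_eq, hc]

open scoped Classical in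
/-- The finitary alternating group `FAlt(α)`: the even permutations of finite support, that is,
the products of an even number of transpositions. -/
def FAlt (α : Type*) : Subgroup (Equiv.Perm α) where
  carrier := {g | ∃ l : List (Equiv.Perm α), (∀ τ ∈ l, τ.IsSwap) ∧ Even l.length ∧ l.prod = g}
  one_mem' := ⟨[], by simp⟩
  mul_mem' := by
    rintro _ _ ⟨l, hl, el, rfl⟩ ⟨k, hk, ek, rfl⟩
    refine ⟨l ++ k, fun τ hτ => ?_, ?_, List.prod_append⟩
    · exact (List.mem_append.1 hτ).elim (hl τ) (hk τ)
    · rw [List.length_append]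
      exact el.add ek
  inv_mem' := by
    rintro _ ⟨l, hl, el, rfl⟩
    refine ⟨(l.map fun τ => τ⁻¹).reverse, fun τ hτ => ?_, by simpa using el,
      (List.prod_inv_reverse l).symm⟩
    simp only [List.mem_reverse, List.mem_map] at hτ
    obtain ⟨σ, hσ, rfl⟩ := hτ
    obtain ⟨x, y, hxy, rfl⟩ := hl σ hσ
    exact ⟨x, y, hxy, Equiv.swap_inv x y⟩

/-- The underlying map of `shift`. -/
def shiftFun {n : ℕ} (a b : Fin n) (x : X n) : X n :=
  if x.1 = a then (a, x.2 + 1)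
  else if x.1 = b then (if x.2 = 0 then (a, 0) else (b, x.2 - 1))
  else x

theorem shiftFun_shiftFun {n : ℕ} {a b : Fin n} (h : a ≠ b) (x : X n) :
    shiftFun b a (shiftFun a b x) = x := by
  obtain ⟨j, m⟩ := x
  unfold shiftFun
  by_cases h1 : j = a
  · subst h1
    simp [h]
  · by_cases h2 : j = b
    · subst h2
      by_cases h3 : m = 0
      · simp [h1, h3, h]
      · simp [h1, h3]
        omega
    · simp [h1, h2]

/-- For distinct rays `a` and `b`: translate the ray `a` by `1`, translate the ray `b` by `-1`,
sending its first point to the first point of `a`, and fix all the other rays pointwise. -/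
def shift {n : ℕ} (a b : Fin n) (h : a ≠ b) : Equiv.Perm (X n) where
  toFun := shiftFun a b
  invFun := shiftFun b a
  left_inv := shiftFun_shiftFun h
  right_inv := shiftFun_shiftFun h.symm

/-- The subgroup `U_p` of `H_n`, generated by `FAlt(X_n)` and the `p`-th powers of the standard
elements `g_i`, where `i` runs through the rays other than the first one. -/
def U (n : ℕ) [NeZero n] (p : ℕ) : Subgroup (Equiv.Perm (X n)) :=
  Subgroup.closure
    ((FAlt (X n) : Set (Equiv.Perm (X n))) ∪ {g | ∃ (i : Fin n) (h : 0 ≠ i), g = shift 0 i h ^ p})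

/-- The isometric permutation `(i, m) ↦ (σ i, m)` of the rays of `X_n` induced by `σ`. -/
def rayPerm (n : ℕ) : Equiv.Perm (Fin n) →* Equiv.Perm (X n) where
  toFun σ := Equiv.prodCongr σ (Equiv.refl ℕ)
  map_one' := rfl
  map_mul' _ _ := rfl

/-- The internal semidirect product `H_n ⋊ S_n` in `Sym(X_n)`, where `S_n` is the group of
isometric permutations of the rays, which normalises `H_n` and meets it trivially. -/
def HS (n : ℕ) : Subgroup (Equiv.Perm (X n)) := H n ⊔ (rayPerm n).range

/-- `T_i(V)`: the least positive eventual translation length on the `i`-th ray of an element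
of `V`. -/
noncomputable def T {n : ℕ} (V : Subgroup (Equiv.Perm (X n))) (i : Fin n) : ℕ :=
  sInf {k : ℕ | 0 < k ∧ ∃ u ∈ V, EventualTranslation u i k}

/-- Given positive integers `r_i`, cut the `i`-th ray of `X_n` into its `r_i` residue classes
modulo `r_i`; the point with number `d + r_i * k` becomes the `k`-th point of the `d`-th class. -/
def splitRays {n : ℕ} (r : Fin n → ℕ) (hr : ∀ i, 0 < r i) : X n ≃ (Σ i : Fin n, Fin (r i)) × ℕ where
  toFun x := (⟨x.1, ⟨x.2 % r x.1, Nat.mod_lt _ (hr x.1)⟩⟩, x.2 / r x.1)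
  invFun y := (y.1.1, y.1.2 + r y.1.1 * y.2)
  left_inv x := by simp [Nat.mod_add_div]
  right_inv := by
    rintro ⟨⟨i, d⟩, k⟩
    simp [Nat.mod_eq_of_lt d.2, Nat.add_mul_div_left _ _ (hr i), Nat.div_eq_of_lt d.2]

/-- The bijection `X_n → X_{r_1 + ⋯ + r_n}` which sends the `d`-th residue class of the `i`-th ray,
in order, to the ray with number `r_1 + ⋯ + r_{i-1} + d`. -/
def refineRays {n : ℕ} (r : Fin n → ℕ) (hr : ∀ i, 0 < r i) : X n ≃ X (∑ i, r i) :=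
  (splitRays r hr).trans (Equiv.prodCongr finSigmaFinEquiv (Equiv.refl ℕ))

/-- The image of the normaliser of `V` in `Sym(X_n)` under the isomorphism of `Sym(X_n)` with
`Sym(X_{T_1(V) + ⋯ + T_n(V)})` that `refineRays` induces. -/
noncomputable def refinedNormalizer {n : ℕ} (V : Subgroup (Equiv.Perm (X n))) (hT : ∀ i, 0 < T V i) :
    Subgroup (Equiv.Perm (X (∑ i, T V i))) :=
  (Subgroup.normalizer (V : Set (Equiv.Perm (X n)))).map
    (refineRays (T V) hT).permCongrHom.toMonoidHom

end Houghton

/-! Finite index forces `FAlt ≤ V` (`FAlt_le_of_finiteIndex`) and puts the `p`-th power of every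
shift into `V`, for `p` the factorial of the index. The subgroup sought is `U n (4 * p)`.

Normaliser. After refinement, an element of `V` of length `T_i` on the `i`-th ray has length 1 on
each of its subrays. If `ν` normalises `V`, it carries the orbits of such elements to infinite
orbits of elements of the refined Houghton group, and these end as arithmetic progressions. Applied
to `ν⁻¹` as well, this makes all common differences 1, so `ν` is a ray permutation times an element
of `H` (`exists_rayPerm_mul`). That ray permutation maps the subrays of one ray onto the subrays of
one ray, because `p`-th powers of shifts tell rays apart by sign; so conjugation by `ν` only
permutes the lengths of elements of `V` (`dvd_trans_conj`). Modulo `FAlt`, commutators of `H` are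
central of order at most 2, so fourth powers are multiplicative, and an element with all lengths
divisible by `p` has its fourth power in `U n (4 * p)` (`pow_four_mem_U`). Hence `ν` normalises `U n
(4 * p)`.

Characteristic. Every automorphism of `V` is conjugation by a permutation (`equiv_eq_conj`), so the
previous step applies. Such an automorphism preserves `FAlt`, where three-cycles are recognised
algebraically and the points are recovered from their incidences.

Lower bounds. An element `h` normalises the refined `V` as soon as its commutators with it lie
there. These commutators are finitary, and by bilinearity modulo `FAlt` they are even whenever `∑
t_k(h) t_k(u)` is even (`commutator_mem_FAlt_of_even`). -/

namespace Houghton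

/-! ### Finitary permutations, the quotient by `FAlt`, and three-cycles. -/

section Finitary

open Equiv Equiv.Perm
open scoped commutatorElement

variable {α : Type*} [DecidableEq α]

theorem swap_mul_swap_mem_FAlt {a b c d : α} (hab : a ≠ b) (hcd : c ≠ d) :
    swap a b * swap c d ∈ FAlt α := by
  refine ⟨[swap a b, swap c d], ?_, by simp, by simp⟩
  intro τ hτ
  simp only [List.mem_cons, List.not_mem_nil, or_false] at hτ
  rcases hτ with rfl | rfl
  · exact ⟨a, b, hab, by congr!⟩
  · exact ⟨c, d, hcd, by congr!⟩

theorem FAlt_le_of_swap_mul_swap_mem {K : Subgroup (Perm α)}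
    (hK : ∀ a b c d : α, a ≠ b → c ≠ d → swap a b * swap c d ∈ K) : FAlt α ≤ K := by
  rintro _ ⟨l, hl, he, rfl⟩
  obtain ⟨k, hk⟩ := he
  induction k generalizing l with
  | zero =>
    have : l = [] := List.length_eq_zero_iff.1 (by simpa using hk)
    simp [this]
  | succ k ih =>
    match l, hl, hk with
    | [], _, hk => simp at hk
    | [_], _, hk => simp at hk; omega
    | σ :: τ :: l, hl, hk =>
      rw [List.prod_cons, List.prod_cons, ← mul_assoc]
      refine K.mul_mem ?_ (ih l (fun ρ hρ => hl ρ (by simp [hρ])) (by simp at hk; omega))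
      obtain ⟨a, b, hab, rfl⟩ := hl σ (by simp)
      obtain ⟨c, d, hcd, rfl⟩ := hl τ (by simp)
      convert hK a b c d hab hcd using 3

instance FAlt_normal (α : Type*) : (FAlt α).Normal where
  conj_mem := by
    classical
    intro f hf g
    have : FAlt α ≤ (FAlt α).comap (MulAut.conj g).toMonoidHom := by
      refine FAlt_le_of_swap_mul_swap_mem fun a b c d hab hcd => ?_
      have h := swap_mul_swap_mem_FAlt (g.injective.ne hab) (g.injective.ne hcd)
      rw [Subgroup.mem_comap]
      simpa [swap_apply_apply, mul_assoc] using h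
    exact this hf

theorem swap_mem_FSym (a b : α) : swap a b ∈ FSym α := by
  refine Set.Finite.subset (Set.toFinite {a, b}) fun x hx => ?_
  by_contra h
  simp only [Set.mem_insert_iff, Set.mem_singleton_iff, not_or] at h
  exact hx (swap_apply_of_ne_of_ne h.1 h.2)

theorem FAlt_le_FSym (α : Type*) : FAlt α ≤ FSym α := by
  classical
  exact FAlt_le_of_swap_mul_swap_mem fun a b c d _ _ =>
    (FSym α).mul_mem (swap_mem_FSym a b) (swap_mem_FSym c d)

theorem mk_swap_eq_mk_swap {a b c d : α} (hab : a ≠ b) (hcd : c ≠ d) :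
    (QuotientGroup.mk (swap a b) : Perm α ⧸ FAlt α) = QuotientGroup.mk (swap c d) := by
  rw [QuotientGroup.eq, swap_inv]
  exact swap_mul_swap_mem_FAlt hab hcd

/-- Conjugates of a transposition are transpositions, and all transpositions agree modulo `FAlt`. So
the image of `FSym` in the quotient is central, of order at most 2. -/
theorem mk_swap_comm {a b : α} (hab : a ≠ b) (x : Perm α ⧸ FAlt α) :
    Commute (QuotientGroup.mk (swap a b)) x := by
  obtain ⟨g, rfl⟩ := QuotientGroup.mk_surjective x
  have h : g * swap a b = swap (g a) (g b) * g := by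
    rw [swap_apply_apply]; group
  rw [Commute, SemiconjBy, ← QuotientGroup.mk_mul, ← QuotientGroup.mk_mul, h, QuotientGroup.mk_mul,
    QuotientGroup.mk_mul, mk_swap_eq_mk_swap hab (g.injective.ne hab)]

theorem mk_swap_sq {a b : α} :
    (QuotientGroup.mk (swap a b) : Perm α ⧸ FAlt α) ^ 2 = 1 := by
  rw [← QuotientGroup.mk_pow, sq, swap_mul_self, QuotientGroup.mk_one]

theorem FSym_eq_closure : FSym α = Subgroup.closure {σ | σ.IsSwap} := by
  ext f
  rw [mem_closure_isSwap']
  rfl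

theorem mk_mem_zpowers_of_mem_FSym {a b : α} (hab : a ≠ b) {f : Perm α} (hf : f ∈ FSym α) :
    (QuotientGroup.mk f : Perm α ⧸ FAlt α) ∈ Subgroup.zpowers (QuotientGroup.mk (swap a b)) := by
  rw [FSym_eq_closure] at hf
  have : Subgroup.closure {σ : Perm α | σ.IsSwap} ≤
      (Subgroup.zpowers (QuotientGroup.mk (swap a b))).comap (QuotientGroup.mk' (FAlt α)) := by
    rw [Subgroup.closure_le]
    rintro _ ⟨c, d, hcd, rfl⟩
    exact Subgroup.mem_zpowers_iff.2 ⟨1, by simpa using mk_swap_eq_mk_swap hab hcd⟩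
  exact this hf

theorem mk_comm_of_mem_FSym {f : Perm α} (hf : f ∈ FSym α) (x : Perm α ⧸ FAlt α) :
    Commute (QuotientGroup.mk f) x := by
  by_cases h : ∃ a b : α, a ≠ b
  · obtain ⟨a, b, hab⟩ := h
    obtain ⟨k, hk⟩ := Subgroup.mem_zpowers_iff.1 (mk_mem_zpowers_of_mem_FSym hab hf)
    rw [← hk]
    exact (mk_swap_comm hab x).zpow_left k
  · push Not at h
    have : f = 1 := Equiv.ext fun x => h _ _
    rw [this]
    exact Commute.one_left _

theorem mk_sq_of_mem_FSym {f : Perm α} (hf : f ∈ FSym α) :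
    (QuotientGroup.mk f : Perm α ⧸ FAlt α) ^ 2 = 1 := by
  by_cases h : ∃ a b : α, a ≠ b
  · obtain ⟨a, b, hab⟩ := h
    obtain ⟨k, hk⟩ := Subgroup.mem_zpowers_iff.1 (mk_mem_zpowers_of_mem_FSym hab hf)
    rw [← hk, ← zpow_natCast, zpow_comm, zpow_natCast, mk_swap_sq, one_zpow]
  · push Not at h
    have : f = 1 := Equiv.ext fun x => h _ _
    simp [this]

theorem commutator_mem_FAlt {f g : Perm α} (hf : f ∈ FSym α) : ⁅f, g⁆ ∈ FAlt α := by
  rw [← QuotientGroup.eq_one_iff, commutatorElement_def, QuotientGroup.mk_mul, QuotientGroup.mk_mul,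
    QuotientGroup.mk_mul, (mk_comm_of_mem_FSym hf _).eq, QuotientGroup.mk_inv,
    QuotientGroup.mk_inv]
  simp

/-- The three-cycle `a ↦ b ↦ c ↦ a`. -/
def cyc (a b c : α) : Perm α := swap a b * swap b c

/-- Being a three-cycle, on a type which need not be finite. -/
def IsCyc (f : Perm α) : Prop := ∃ a b c : α, a ≠ b ∧ b ≠ c ∧ a ≠ c ∧ f = cyc a b c

section
variable {a b c : α}

theorem cyc_apply_fst (hab : a ≠ b) (hac : a ≠ c) : cyc a b c a = b := by
  simp [cyc, swap_apply_of_ne_of_ne hab hac]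

theorem cyc_apply_snd (hbc : b ≠ c) (hac : a ≠ c) : cyc a b c b = c := by
  simp [cyc, swap_apply_of_ne_of_ne hac.symm hbc.symm]

theorem cyc_apply_thd : cyc a b c c = a := by
  simp [cyc]

theorem cyc_apply_of_ne {x : α} (ha : x ≠ a) (hb : x ≠ b) (hc : x ≠ c) : cyc a b c x = x := by
  simp [cyc, swap_apply_of_ne_of_ne, *]

theorem cyc_mem_FAlt (hab : a ≠ b) (hbc : b ≠ c) : cyc a b c ∈ FAlt α :=
  swap_mul_swap_mem_FAlt hab hbc

theorem conj_cyc (g : Perm α) : g * cyc a b c * g⁻¹ = cyc (g a) (g b) (g c) := by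
  simp only [cyc, swap_apply_apply]
  group

theorem cyc_eq_of_apply {f : Perm α} (hab : a ≠ b) (hbc : b ≠ c) (hac : a ≠ c) (h₁ : f a = b)
    (h₂ : f b = c) (h₃ : f c = a) (h : ∀ x, x ≠ a → x ≠ b → x ≠ c → f x = x) :
    f = cyc a b c := by
  ext x
  by_cases ha : x = a
  · rw [ha, h₁, cyc_apply_fst hab hac]
  by_cases hb : x = b
  · rw [hb, h₂, cyc_apply_snd hbc hac]
  by_cases hc : x = c
  · rw [hc, h₃, cyc_apply_thd]
  rw [h x ha hb hc, cyc_apply_of_ne ha hb hc]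

theorem cyc_rotate (hab : a ≠ b) (hbc : b ≠ c) (hac : a ≠ c) : cyc a b c = cyc b c a :=
  (cyc_eq_of_apply hab hbc hac cyc_apply_thd (cyc_apply_fst hbc hab.symm)
    (cyc_apply_snd hac.symm hab.symm) fun _ ha hb hc => cyc_apply_of_ne hb hc ha).symm

end

/-- A three-cycle may be written starting with any point that it moves. -/
theorem IsCyc.eq_cyc {f : Perm α} (hf : IsCyc f) {x : α} (hx : f x ≠ x) :
    x ≠ f x ∧ f x ≠ f (f x) ∧ x ≠ f (f x) ∧ f = cyc x (f x) (f (f x)) := by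
  obtain ⟨a, b, c, hab, hbc, hac, rfl⟩ := hf
  have h1 := cyc_apply_fst hab hac
  have h2 := cyc_apply_snd hbc hac
  have h3 : cyc a b c c = a := cyc_apply_thd
  by_cases ha : x = a
  · subst ha
    rw [h1, h2]
    exact ⟨hab, hbc, hac, rfl⟩
  by_cases hb : x = b
  · subst hb
    rw [h2, h3]
    exact ⟨hbc, hac.symm, hab.symm, cyc_rotate hab hbc hac⟩
  by_cases hc : x = c
  · subst hc
    rw [h3, h1]
    exact ⟨hac.symm, hab, hbc.symm, by
      rw [cyc_rotate hab hbc hac, cyc_rotate hbc hac.symm hab.symm]⟩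
  exact absurd (cyc_apply_of_ne ha hb hc) hx

theorem IsCyc.apply_three {f : Perm α} (hf : IsCyc f) (x : α) : f (f (f x)) = x := by
  by_cases hx : f x = x
  · rw [hx, hx, hx]
  obtain ⟨-, -, -, h⟩ := hf.eq_cyc hx
  generalize f x = b at *
  generalize f b = c at *
  rw [h, cyc_apply_thd]

theorem IsCyc.eq_or_of_ne {f : Perm α} (hf : IsCyc f) {x y : α} (hx : f x ≠ x) (hy : f y ≠ y) :
    y = x ∨ y = f x ∨ y = f (f x) := by
  obtain ⟨-, -, -, h⟩ := hf.eq_cyc hx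
  by_contra! hc
  exact hy (by rw [h, cyc_apply_of_ne hc.1 hc.2.1 hc.2.2])

theorem IsCyc.mem_FAlt {f : Perm α} (hf : IsCyc f) : f ∈ FAlt α := by
  obtain ⟨a, b, c, hab, hbc, -, rfl⟩ := hf
  exact cyc_mem_FAlt hab hbc

theorem IsCyc.conj {f : Perm α} (hf : IsCyc f) (g : Perm α) : IsCyc (g * f * g⁻¹) := by
  obtain ⟨a, b, c, hab, hbc, hac, rfl⟩ := hf
  exact ⟨g a, g b, g c, g.injective.ne hab, g.injective.ne hbc, g.injective.ne hac, conj_cyc g⟩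

/-- The three-cycles `cyc a b x`, for two fixed points `a` and `b`, generate `FAlt`. -/
theorem FAlt_le_of_cyc_mem {K : Subgroup (Perm α)} {a b : α} (hab : a ≠ b)
    (hK : ∀ x, x ≠ a → x ≠ b → cyc a b x ∈ K) : FAlt α ≤ K := by
  have key : ∀ x y : α, x ≠ y → swap a b * swap x y ∈ K := by
    have h1 : ∀ x, x ≠ a → swap a b * swap a x ∈ K := by
      intro x hxa
      by_cases hxb : x = b
      · subst hxb; simp
      · have h : swap a b * swap a x = (cyc a b x)⁻¹ := by
          rw [cyc_rotate hab (Ne.symm hxb) (Ne.symm hxa),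
            cyc_rotate (Ne.symm hxb) hxa hab.symm, cyc, mul_inv_rev, swap_inv, swap_inv,
            swap_comm x a]
        rw [h]
        exact K.inv_mem (hK x hxa hxb)
    have h2 : ∀ x, x ≠ a → swap a x * swap a b ∈ K := by
      intro x hxa
      have := K.inv_mem (h1 x hxa)
      rwa [mul_inv_rev, swap_inv, swap_inv] at this
    intro x y hxy
    by_cases hxa : x = a
    · subst hxa; exact h1 y hxy.symm
    by_cases hya : y = a
    · subst hya; rw [swap_comm]; rw [swap_comm x]; rw [swap_comm]; exact h1 x hxa
    have h : swap x y = swap a x * swap a y * swap a x := by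
      have := swap_apply_apply (swap a x) a y
      rw [swap_apply_left, swap_apply_of_ne_of_ne hya hxy.symm, swap_inv] at this
      exact this
    have h' : swap a b * swap x y =
        (swap a b * swap a x) * (swap a y * swap a b) * (swap a b * swap a x) := by
      rw [h]
      simp only [mul_assoc, swap_mul_self_mul]
    rw [h']
    exact K.mul_mem (K.mul_mem (h1 x hxa) (h2 y hya)) (h1 x hxa)
  refine FAlt_le_of_swap_mul_swap_mem fun x y z w hxy hzw => ?_
  have h : swap x y * swap z w = (swap a b * swap x y)⁻¹ * (swap a b * swap z w) := by
    rw [mul_inv_rev, swap_inv, swap_inv, mul_assoc, swap_mul_self_mul]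
  rw [h]
  exact K.mul_mem (K.inv_mem (key x y hxy)) (key z w hzw)

end Finitary

/-! ### Automorphisms of groups between `FAlt` and `Perm` are conjugations. -/

section Automorphisms

open Equiv Equiv.Perm
open scoped commutatorElement

variable {α : Type*} [DecidableEq α]

/-- A permutation of at most six points has order dividing `60`. -/
theorem pow_sixty_eq_one {w : Perm α} {S : Finset α} (hS : S.card ≤ 6)
    (hw : ∀ x, x ∉ S → w x = x) : w ^ 60 = 1 := by
  have hmaps : ∀ x ∈ S, w x ∈ S := by
    intro x hx
    by_contra h
    exact h (by rwa [w.injective (hw _ h)])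
  ext x
  by_cases hx : x ∈ S
  · have hpow : ∀ k : ℕ, (w ^ k) x ∈ S := by
      intro k
      induction k with
      | zero => simpa using hx
      | succ k ih => rw [pow_succ', Perm.mul_apply]; exact hmaps _ ih
    obtain ⟨i, hi, j, hj, hij, h⟩ := Finset.exists_ne_map_eq_of_card_lt_of_maps_to
      (s := Finset.range 7) (t := S) (f := fun k => (w ^ k) x) (by simp; omega)
      (fun k _ => hpow k)
    wlog hlt : i < j generalizing i j
    · exact this j hj i hi hij.symm h.symm (by omega)
    have hfix : (w ^ (j - i)) x = x := by
      apply (w ^ i).injective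
      rw [← Perm.mul_apply, ← pow_add]
      simpa [show i + (j - i) = j by omega] using h.symm
    have hdvd : (j - i) ∣ 60 := by
      rw [Finset.mem_range] at hj
      have : 0 < j - i := by omega
      have : j - i < 7 := by omega
      generalize j - i = d at *
      interval_cases d <;> norm_num
    obtain ⟨q, hq⟩ := hdvd
    rw [hq, pow_mul, Perm.one_apply]
    exact Perm.pow_apply_eq_self_of_apply_eq_self hfix q
  · rw [Perm.one_apply]
    exact Perm.pow_apply_eq_self_of_apply_eq_self (hw x hx) 60

theorem IsCyc.mul_pow_sixty {f f' : Perm α} (hf : IsCyc f) (hf' : IsCyc f') :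
    (f * f') ^ 60 = 1 := by
  obtain ⟨a, b, c, -, -, -, rfl⟩ := hf
  obtain ⟨a', b', c', -, -, -, rfl⟩ := hf'
  refine pow_sixty_eq_one (S := {a, b, c, a', b', c'}) Finset.card_le_six fun x hx => ?_
  simp only [Finset.mem_insert, Finset.mem_singleton, not_or] at hx
  rw [Perm.mul_apply, cyc_apply_of_ne hx.2.2.2.1 hx.2.2.2.2.1 hx.2.2.2.2.2,
    cyc_apply_of_ne hx.1 hx.2.1 hx.2.2.1]

/-- An algebraic description of the three-cycles in `FAlt`. -/
theorem isCyc_of_pow_sixty [Infinite α] {f : Perm α} (hf : f ∈ FSym α) (h1 : f ≠ 1)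
    (h3 : f ^ 3 = 1) (h : ∀ g ∈ FAlt α, (f * (g * f * g⁻¹)) ^ 60 = 1) : IsCyc f := by
  have h3' : ∀ x, f (f (f x)) = x := fun x => by
    have := congrArg (fun g : Perm α => g x) h3
    simpa [pow_succ] using this
  obtain ⟨a, ha⟩ : ∃ a, f a ≠ a := by
    by_contra! hc
    exact h1 (Equiv.ext hc)
  obtain ⟨b, hb⟩ : ∃ b, f a = b := ⟨_, rfl⟩
  obtain ⟨c, hc⟩ : ∃ c, f b = c := ⟨_, rfl⟩
  have hca : f c = a := by rw [← hc, ← hb, h3']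
  have hab : a ≠ b := by rw [← hb]; exact ha.symm
  have hbc : b ≠ c := fun e => hab (by rw [← hca, ← e, hc, ← e])
  have hac : a ≠ c := fun e => ha ((congrArg f e).trans hca)
  by_cases hall : ∀ x, x ≠ a → x ≠ b → x ≠ c → f x = x
  · exact ⟨a, b, c, hab, hbc, hac, cyc_eq_of_apply hab hbc hac hb hc hca hall⟩
  exfalso
  push Not at hall
  obtain ⟨d, hda, hdb, hdc, hd⟩ := hall
  obtain ⟨e, he⟩ : ∃ e, f d = e := ⟨_, rfl⟩
  obtain ⟨k, hk⟩ : ∃ k, f e = k := ⟨_, rfl⟩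
  have hkd : f k = d := by rw [← hk, ← he, h3']
  obtain ⟨y, hy⟩ : ∃ y, y ∉ {x | f x ≠ x} := hf.exists_notMem
  have hy : f y = y := by simpa using hy
  have hde : d ≠ e := by rw [← he]; exact hd.symm
  have inj := f.injective
  have hne : [a, b, c, d, e, k, y].Nodup := by
    simp only [List.nodup_cons, List.mem_cons, List.not_mem_nil, or_false, not_or, not_false_iff,
      List.nodup_nil, and_true]
    refine ⟨⟨?_, ?_, ?_, ?_, ?_, ?_⟩, ⟨?_, ?_, ?_, ?_, ?_⟩, ⟨?_, ?_, ?_, ?_⟩, ⟨?_, ?_, ?_⟩,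
      ⟨?_, ?_⟩, ?_⟩ <;> grind
  simp only [List.nodup_cons, List.mem_cons, List.not_mem_nil, or_false, not_or, not_false_iff,
      List.nodup_nil, and_true] at hne
  obtain ⟨⟨-, -, had, hae, hak, hay⟩, ⟨-, hbd, hbe, hbk, hby⟩, ⟨hcd, hce, hck, hcy⟩,
    ⟨-, hdk, hdy⟩, ⟨hek, hey⟩, hky⟩ := hne
  -- If `f` has a second cycle `d, e, k` and a fixed point `y`, this `g` makes `f * (g * f * g⁻¹)`
  -- contain the 7-cycle `a, k, b, c, e, d, y`. As 7 does not divide 60 = lcm(1, …, 6), the 60th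
  -- power is not trivial.
  have hg := h (swap a d * swap b y) (swap_mul_swap_mem_FAlt had hby)
  set g := swap a d * swap b y with hgdef
  have ga : g a = d := by simp [g, swap_apply_of_ne_of_ne hab hay]
  have gb : g b = y := by
    simp [hgdef, swap_apply_of_ne_of_ne (Ne.symm hay) (Ne.symm hdy)]
  have gc : g c = c := by
    simp [hgdef, swap_apply_of_ne_of_ne hbc.symm hcy, swap_apply_of_ne_of_ne hac.symm hcd]
  have gd : g d = a := by simp [hgdef, swap_apply_of_ne_of_ne hdb hdy]
  have ge : g e = e := by
    simp [hgdef, swap_apply_of_ne_of_ne (Ne.symm hbe) hey,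
      swap_apply_of_ne_of_ne (Ne.symm hae) hde.symm]
  have gk : g k = k := by
    simp [hgdef, swap_apply_of_ne_of_ne (Ne.symm hbk) hky,
      swap_apply_of_ne_of_ne (Ne.symm hak) (Ne.symm hdk)]
  have gy : g y = b := by simp [hgdef, swap_apply_of_ne_of_ne hab.symm hbd]
  set w := f * (g * f * g⁻¹) with hw
  have hwg : ∀ x, w (g x) = f (g (f x)) := fun x => by simp [hw]
  have w0 : w a = k := by rw [← gd, hwg, he, ge, hk]
  have w1 : w k = b := by rw [← gk, hwg, hkd, gd, hb]
  have w2 : w b = c := by rw [← gy, hwg, hy, gy, hc]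
  have w3 : w c = e := by rw [← gc, hwg, hca, ga, he]
  have w4 : w e = d := by rw [← ge, hwg, hk, gk, hkd]
  have w5 : w d = y := by rw [← ga, hwg, hb, gb, hy]
  have w6 : w y = a := by rw [← gb, hwg, hc, gc, hca]
  have w7 : (w ^ 7) a = a := by simp [pow_succ, w0, w1, w2, w3, w4, w5, w6]
  have w56 : (w ^ 56) a = a := by
    rw [show 56 = 7 * 8 from rfl, pow_mul]
    exact Perm.pow_apply_eq_self_of_apply_eq_self w7 8
  have w60 : (w ^ 60) a = e := by
    rw [show 60 = 4 + 56 from rfl, pow_add, Perm.mul_apply, w56]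
    simp [pow_succ, w0, w1, w2, w3]
  rw [hg, Perm.one_apply] at w60
  exact hae w60

/-- Two three-cycles whose product has order two agree at a point that they move. -/
theorem IsCyc.exists_common_edge {f f' : Perm α} (hf : IsCyc f) (hf' : IsCyc f')
    (hne : f * f' ≠ 1) (hsq : (f * f') ^ 2 = 1) : ∃ s, f s ≠ s ∧ f' s = f s := by
  have hsq' : ∀ x, f (f' (f (f' x))) = x := fun x => by
    have := congrArg (fun g : Perm α => g x) hsq
    simpa [pow_succ] using this
  by_cases hv : ∃ v, f' v ≠ v ∧ f v = v
  · obtain ⟨v, hv', hv⟩ := hv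
    obtain ⟨-, h1, h2, -⟩ := hf'.eq_cyc hv'
    have h4 := hsq' (f' (f' v))
    rw [hf'.apply_three, hv] at h4
    exact ⟨f' v, by rw [h4]; exact h1.symm, h4.symm⟩
  -- Now the two supports coincide, so `f'` is `f` or its inverse, and the inverse is excluded by
  -- `hne`.
  · push Not at hv
    obtain ⟨p, hp⟩ : ∃ p, f' p ≠ p := by
      obtain ⟨a, b, c, hab, -, hac, rfl⟩ := hf'
      exact ⟨a, by rw [cyc_apply_fst hab hac]; exact hab.symm⟩
    obtain ⟨-, h1, h2, h3⟩ := hf'.eq_cyc hp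
    have hfp := hv p hp
    rcases hf.eq_or_of_ne hfp (hv (f' p) (fun e => h1 e.symm)) with h | h | h
    · exact absurd h hp
    · exact ⟨p, hfp, h⟩
    · exfalso
      have hff : f' (f' p) = f p := by
        have h5 := hf.eq_or_of_ne hfp (hv (f' (f' p)) (by rw [hf'.apply_three]; exact h2))
        rcases h5 with h5 | h5 | h5
        · exact absurd h5.symm h2
        · exact h5
        · exact absurd (h.trans h5.symm) h1
      apply hne
      ext x
      rw [Perm.mul_apply, Perm.one_apply]
      by_cases hx : f' x = x
      · rw [hx]
        by_contra hfx
        rcases hf.eq_or_of_ne hfp hfx with rfl | rfl | rfl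
        · exact hp hx
        · rw [← hff, hf'.apply_three] at hx
          exact h2 hx
        · rw [← h] at hx
          exact h1 hx.symm
      · rcases hf'.eq_or_of_ne hp hx with rfl | rfl | rfl
        · rw [h, hf.apply_three]
        · rw [hff, h]
        · rw [hf'.apply_three, hff]

/-- Three pairwise adjacent three-cycles have an edge in common. -/
theorem IsCyc.apply_eq_of_common_edges {f f' k : Perm α} (hf : IsCyc f) (hf' : IsCyc f')
    (hk : IsCyc k) {s : α} (hs : f s ≠ s) (hs' : f' s = f s) (hne : f ≠ f')
    (h : ∃ u, f u ≠ u ∧ k u = f u) (h' : ∃ u, f' u ≠ u ∧ k u = f' u) : k s = f s := by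
  obtain ⟨u, hu, hku⟩ := h
  obtain ⟨u', hu', hku'⟩ := h'
  obtain ⟨a1, a2, a3, a4⟩ := hf.eq_cyc hs
  obtain ⟨b1, b2, b3, b4⟩ := hf'.eq_cyc (x := s) (by rwa [hs'])
  rw [hs'] at b1 b2 b3 b4
  have hr : f (f s) ≠ f' (f s) := fun e => hne (by rw [a4, b4, ← e])
  have c1 := hf.eq_or_of_ne hs hu
  have c2 := hf'.eq_or_of_ne (x := s) (by rwa [hs']) hu'
  have c3 := hf.apply_three s
  have c4 := hf'.apply_three s
  have c5 : ∀ x, k (k (k x)) = x := hk.apply_three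
  have c6 : ∀ x y, k x ≠ x → k y ≠ y → y = x ∨ y = k x ∨ y = k (k x) :=
    fun x y => hk.eq_or_of_ne
  have c7 := k.injective
  rw [hs'] at c2 c4
  -- If `k` missed the edge at `s`, it would use another edge of `f` and another edge of `f'`; as
  -- these cycles have different third points, `k` would be non-injective, ambiguous, or move four
  -- points.
  rcases c1 with rfl | rfl | rfl
  · exact hku
  · rcases c2 with rfl | rfl | rfl <;> grind
  · rcases c2 with rfl | rfl | rfl <;> grind

theorem cyc_mul_cyc_sq {a b x y : α} (hab : a ≠ b) (hax : a ≠ x) (hay : a ≠ y) (hbx : b ≠ x)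
    (hxy : x ≠ y) : (cyc a b x * cyc a b y) ^ 2 = 1 := by
  have h : cyc a b x * cyc a b y = swap a x * swap b y := by
    have e : swap a x * swap a b = swap a b * swap b x := by
      have := swap_apply_apply (swap a b) b x
      rw [swap_apply_right, swap_apply_of_ne_of_ne hax.symm hbx.symm, swap_inv] at this
      rw [this]; simp [mul_assoc]
    rw [cyc, cyc, ← e, mul_assoc, swap_mul_self_mul]
  have hd : Commute (swap a x) (swap b y) :=
    (Perm.disjoint_iff_eq_or_eq.2 fun z => by
      by_cases h1 : z = a
      · right; rw [h1, swap_apply_of_ne_of_ne hab hay]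
      by_cases h2 : z = x
      · right; rw [h2, swap_apply_of_ne_of_ne hbx.symm hxy]
      left; exact swap_apply_of_ne_of_ne h1 h2).commute
  rw [h, hd.mul_pow, sq, sq, swap_mul_self, swap_mul_self, one_mul]

theorem cyc_mul_cyc_ne_one {a b x y : α} (hab : a ≠ b) (hax : a ≠ x) (hbx : b ≠ x)
    (hay : a ≠ y) : cyc a b x * cyc a b y ≠ 1 := by
  intro h
  have := congrArg (fun g : Perm α => g a) h
  simp [cyc_apply_fst hab hay, cyc_apply_snd hbx hax] at this
  exact hax this.symm

/-- The description of three-cycles in `isCyc_of_pow_sixty` only uses the group structure of `FAlt`,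
so automorphisms preserve it. -/
theorem IsCyc.map_equiv [Infinite α] (e : FAlt α ≃* FAlt α) {f : FAlt α}
    (hf : IsCyc (f : Perm α)) : IsCyc (e f : Perm α) := by
  apply isCyc_of_pow_sixty (FAlt_le_FSym α (e f).2)
  · intro h
    have h1 : f = 1 := e.injective (by rw [map_one]; exact Subtype.ext h)
    obtain ⟨a, b, c, hab, -, hac, hf⟩ := hf
    have := cyc_apply_fst hab hac
    rw [← hf, h1] at this
    exact hab this
  · have h : f ^ 3 = 1 := Subtype.ext (Equiv.ext fun x => by
      simpa [pow_succ] using hf.apply_three x)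
    rw [← Subgroup.coe_pow, ← map_pow, h, map_one, Subgroup.coe_one]
  · intro g hg
    obtain ⟨g', hg'⟩ := e.surjective ⟨g, hg⟩
    have h : (f * (g' * f * g'⁻¹)) ^ 60 = 1 :=
      Subtype.ext (by simpa using hf.mul_pow_sixty (hf.conj (g' : Perm α)))
    have := congrArg (fun x => ((e x : FAlt α) : Perm α)) h
    simpa [hg'] using this

/-- Every automorphism of `FAlt` is induced by a permutation. -/
theorem FAlt_equiv_eq_conj [Infinite α] (e : FAlt α ≃* FAlt α) :
    ∃ ν : Perm α, ∀ f : FAlt α, (e f : Perm α) = ν * f * ν⁻¹ := by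
  obtain ⟨a, b, hab⟩ := exists_pair_ne α
  let c : α → FAlt α := fun x =>
    if h : b ≠ x then ⟨cyc a b x, cyc_mem_FAlt hab h⟩ else 1
  have hc : ∀ x, x ≠ a → x ≠ b → (c x : Perm α) = cyc a b x := fun x _ h => by
    simp [c, Ne.symm h]
  let F : α → Perm α := fun x => e (c x)
  have hF : ∀ x, x ≠ a → x ≠ b → IsCyc (F x) := fun x hxa hxb =>
    IsCyc.map_equiv e (by
      rw [hc x hxa hxb]
      exact ⟨a, b, x, hab, hxb.symm, hxa.symm, rfl⟩)
  have hcinj : ∀ x y, x ≠ a → x ≠ b → y ≠ a → y ≠ b → F x = F y → x = y := by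
    intro x y hxa hxb hya hyb h
    have h1 : c x = c y := e.injective (Subtype.ext h)
    have h2 : cyc a b x b = cyc a b y b := by rw [← hc x hxa hxb, ← hc y hya hyb, h1]
    rwa [cyc_apply_snd hxb.symm hxa.symm, cyc_apply_snd hyb.symm hya.symm] at h2
  have hedge : ∀ x y, x ≠ a → x ≠ b → y ≠ a → y ≠ b → ∃ s, F x s ≠ s ∧ F y s = F x s := by
    intro x y hxa hxb hya hyb
    by_cases hxy : x = y
    · subst hxy
      obtain ⟨p, q, r, hpq, -, hpr, h⟩ := hF x hxa hxb
      exact ⟨p, by rw [h, cyc_apply_fst hpq hpr]; exact hpq.symm, rfl⟩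
    apply (hF x hxa hxb).exists_common_edge (hF y hya hyb)
    · intro h
      have h1 : c x * c y = 1 := e.injective (by
        rw [map_mul, map_one]; exact Subtype.ext h)
      refine cyc_mul_cyc_ne_one hab hxa.symm hxb.symm hya.symm ?_
      rw [← hc x hxa hxb, ← hc y hya hyb, ← Subgroup.coe_mul, h1, Subgroup.coe_one]
    · have h1 : (c x * c y) ^ 2 = 1 := Subtype.ext (by
        rw [Subgroup.coe_pow, Subgroup.coe_mul, hc x hxa hxb, hc y hya hyb, Subgroup.coe_one]
        exact cyc_mul_cyc_sq hab hxa.symm hya.symm hxb.symm hxy)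
      have := congrArg (fun x => ((e x : FAlt α) : Perm α)) h1
      simpa using this
  -- Two distinct members of the family `F` fix a common edge from `p` to `q`; every other member
  -- meets both, hence contains that edge too.
  obtain ⟨x₀, hx₀⟩ := Infinite.exists_notMem_finset ({a, b} : Finset α)
  obtain ⟨y₀, hy₀⟩ := Infinite.exists_notMem_finset ({a, b, x₀} : Finset α)
  simp only [Finset.mem_insert, Finset.mem_singleton, not_or] at hx₀ hy₀
  obtain ⟨p, hp, hp'⟩ := hedge x₀ y₀ hx₀.1 hx₀.2 hy₀.1 hy₀.2.1
  obtain ⟨q, hq⟩ : ∃ q, F x₀ p = q := ⟨_, rfl⟩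
  have hFp : ∀ x, x ≠ a → x ≠ b → F x p = q := by
    intro x hxa hxb
    rw [← hq]
    refine (hF x₀ hx₀.1 hx₀.2).apply_eq_of_common_edges (hF y₀ hy₀.1 hy₀.2.1) (hF x hxa hxb) hp hp'
      (fun h => hy₀.2.2 (hcinj _ _ hx₀.1 hx₀.2 hy₀.1 hy₀.2.1 h).symm)
      (hedge _ _ hx₀.1 hx₀.2 hxa hxb) (hedge _ _ hy₀.1 hy₀.2.1 hxa hxb)
  have hpq : p ≠ q := by rw [← hq]; exact hp.symm
  have hcyc : ∀ x, x ≠ a → x ≠ b → q ≠ F x q ∧ p ≠ F x q ∧ F x = cyc p q (F x q) := by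
    intro x hxa hxb
    have h := (hF x hxa hxb).eq_cyc (x := p) (by rw [hFp x hxa hxb]; exact hpq.symm)
    rw [hFp x hxa hxb] at h
    exact ⟨h.2.1, h.2.2.1, h.2.2.2⟩
  -- The conjugating permutation must send `a, b` to `p, q` and `x` to the third point of `F x`.
  let n : α → α := fun x => if x = a then p else if x = b then q else F x q
  have na : n a = p := by simp [n]
  have nb : n b = q := by simp [n, hab.symm]
  have nx : ∀ x, x ≠ a → x ≠ b → n x = F x q := fun x h1 h2 => by simp [n, h1, h2]
  have ninj : Function.Injective n := by
    intro x y hxy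
    by_cases hxa : x = a
    · subst hxa
      by_contra hya
      by_cases hyb : y = b
      · subst hyb; exact hpq (by rw [← na, ← nb, hxy])
      · rw [na, nx y (Ne.symm hya) hyb] at hxy
        exact (hcyc y (Ne.symm hya) hyb).2.1 hxy
    by_cases hxb : x = b
    · subst hxb
      by_contra hyb
      by_cases hya : y = a
      · subst hya; exact hpq (by rw [← na, ← nb, hxy])
      · rw [nb, nx y hya (Ne.symm hyb)] at hxy
        exact (hcyc y hya (Ne.symm hyb)).1 hxy
    by_cases hya : y = a
    · subst hya
      rw [na, nx x hxa hxb] at hxy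
      exact absurd hxy.symm (hcyc x hxa hxb).2.1
    by_cases hyb : y = b
    · subst hyb
      rw [nb, nx x hxa hxb] at hxy
      exact absurd hxy.symm (hcyc x hxa hxb).1
    rw [nx x hxa hxb, nx y hya hyb] at hxy
    apply hcinj x y hxa hxb hya hyb
    rw [(hcyc x hxa hxb).2.2, (hcyc y hya hyb).2.2, hxy]
  have nsurj : Function.Surjective n := by
    intro y
    by_contra! hy
    -- The elements of `FAlt` whose image under `e` fixes a missed point `y`. It contains all
    -- generators, yet `e` is onto and some three-cycle moves `y`.
    let K : Subgroup (Perm α) :=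
      ((MulAction.stabilizer (Perm α) y).comap ((FAlt α).subtype.comp e.toMonoidHom)).map
        (FAlt α).subtype
    have hK : FAlt α ≤ K := by
      refine FAlt_le_of_cyc_mem hab fun x hxa hxb => ⟨c x, ?_, hc x hxa hxb⟩
      change F x y = y
      rw [(hcyc x hxa hxb).2.2]
      exact cyc_apply_of_ne (by rw [← na]; exact (hy a).symm) (by rw [← nb]; exact (hy b).symm)
        (by rw [← nx x hxa hxb]; exact (hy x).symm)
    obtain ⟨z, hz⟩ := Infinite.exists_notMem_finset ({y} : Finset α)
    obtain ⟨z', hz'⟩ := Infinite.exists_notMem_finset ({y, z} : Finset α)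
    simp only [Finset.mem_insert, Finset.mem_singleton, not_or] at hz hz'
    obtain ⟨f, hf⟩ := e.surjective ⟨cyc y z z', cyc_mem_FAlt (Ne.symm hz) (Ne.symm hz'.2)⟩
    obtain ⟨f', hf', hff⟩ := hK f.2
    have hff : f' = f := Subtype.ext hff
    subst hff
    have : (e f' : Perm α) y = y := hf'
    rw [hf] at this
    exact hz ((cyc_apply_fst (Ne.symm hz) (Ne.symm hz'.1)).symm.trans this)
  let ν : Perm α := Equiv.ofBijective n ⟨ninj, nsurj⟩
  refine ⟨ν, ?_⟩
  let K : Subgroup (Perm α) :=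
    (((FAlt α).subtype.comp e.toMonoidHom).eqLocus
      ((MulAut.conj ν).toMonoidHom.comp (FAlt α).subtype)).map (FAlt α).subtype
  have hK : FAlt α ≤ K := by
    refine FAlt_le_of_cyc_mem hab fun x hxa hxb => ⟨c x, ?_, hc x hxa hxb⟩
    change F x = ν * c x * ν⁻¹
    rw [hc x hxa hxb, conj_cyc, (hcyc x hxa hxb).2.2, ← nx x hxa hxb]
    exact congrArg₂ (fun s t => cyc s t (n x)) na.symm nb.symm
  intro f
  obtain ⟨f', hf', hff⟩ := hK f.2
  have hff : f' = f := Subtype.ext hff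
  subst hff
  exact hf'

/-- Conjugation by `cyc p s t` turns `cyc p q r` into `cyc s q r`, and `cyc p q s * cyc s q r = cyc
p q r`. -/
theorem commutator_cyc {p q r s t : α} (hpr : p ≠ r) (hpq : p ≠ q) (hps : p ≠ s) (hpt : p ≠ t)
    (hqs : q ≠ s) (hqt : q ≠ t) (hrs : r ≠ s) (hrt : r ≠ t) :
    cyc p q s = ⁅cyc p q r, cyc p s t⁆ := by
  have h1 : cyc p q s * cyc s q r = cyc p q r := by
    rw [cyc, cyc, cyc, swap_comm s q]
    simp [mul_assoc]
  have h2 : cyc p s t * cyc p q r * (cyc p s t)⁻¹ = cyc s q r := by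
    rw [conj_cyc, cyc_apply_fst hps hpt, cyc_apply_of_ne hpq.symm hqs hqt,
      cyc_apply_of_ne hpr.symm hrs hrt]
  rw [eq_mul_inv_of_mul_eq h1, ← h2, commutatorElement_def]
  group

/-- Every three-cycle is the commutator of two three-cycles. -/
theorem IsCyc.exists_commutator [Infinite α] {f : Perm α} (hf : IsCyc f) :
    ∃ g k : Perm α, IsCyc g ∧ IsCyc k ∧ f = ⁅g, k⁆ := by
  obtain ⟨p, q, s, hpq, hqs, hps, rfl⟩ := hf
  obtain ⟨r, hr⟩ := Infinite.exists_notMem_finset ({p, q, s} : Finset α)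
  obtain ⟨t, ht⟩ := Infinite.exists_notMem_finset ({p, q, s, r} : Finset α)
  simp only [Finset.mem_insert, Finset.mem_singleton, not_or] at hr ht
  obtain ⟨hrp, hrq, hrs⟩ := hr
  obtain ⟨htp, htq, hts, htr⟩ := ht
  exact ⟨_, _, ⟨p, q, r, hpq, Ne.symm hrq, Ne.symm hrp, rfl⟩,
    ⟨p, s, t, hps, Ne.symm hts, Ne.symm htp, rfl⟩,
    commutator_cyc (Ne.symm hrp) hpq hps (Ne.symm htp) hqs (Ne.symm htq) hrs (Ne.symm htr)⟩

theorem FAlt_le_of_isCyc_mem [Infinite α] {K : Subgroup (Perm α)}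
    (hK : ∀ f, IsCyc f → f ∈ K) : FAlt α ≤ K := by
  obtain ⟨a, b, hab⟩ := exists_pair_ne α
  exact FAlt_le_of_cyc_mem hab fun x hxa hxb => hK _ ⟨a, b, x, hab, hxb.symm, hxa.symm, rfl⟩

/-- Three-cycles are commutators of three-cycles. Applied once, this sends `FAlt` into the
commutators of `V`, which are finitary; applied again, into commutators of finitary permutations,
which are even. -/
theorem map_mem_FAlt [Infinite α] {V : Subgroup (Perm α)} (hV : FAlt α ≤ V)
    (hcomm : ∀ x ∈ V, ∀ y ∈ V, ⁅x, y⁆ ∈ FSym α) (e : V ≃* V) {f : V} (hf : (f : Perm α) ∈ FAlt α) :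
    (e f : Perm α) ∈ FAlt α := by
  have key : ∀ {L : Subgroup (Perm α)}, (∀ f : V, IsCyc (f : Perm α) → (e f : Perm α) ∈ L) →
      ∀ f : V, (f : Perm α) ∈ FAlt α → (e f : Perm α) ∈ L := by
    intro L hL f hf
    have : FAlt α ≤ (L.comap (V.subtype.comp e.toMonoidHom)).map V.subtype :=
      FAlt_le_of_isCyc_mem fun f hf => ⟨⟨f, hV hf.mem_FAlt⟩, hL _ hf, rfl⟩
    obtain ⟨f', hf', hff⟩ := this hf
    have hff : f' = f := Subtype.ext hff
    subst hff
    exact hf'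
  have hcoe : ∀ g k : V, ((e ⁅g, k⁆ : V) : Perm α) = ⁅(e g : Perm α), (e k : Perm α)⁆ := by
    intro g k
    simp [commutatorElement_def]
  have h1 : ∀ f : V, (f : Perm α) ∈ FAlt α → (e f : Perm α) ∈ FSym α := by
    refine key fun f hf => ?_
    obtain ⟨g, k, hg, hk, h⟩ := hf.exists_commutator
    have : f = ⁅(⟨g, hV hg.mem_FAlt⟩ : V), ⟨k, hV hk.mem_FAlt⟩⁆ := Subtype.ext h
    rw [this, hcoe]
    exact hcomm _ (e _).2 _ (e _).2
  refine key (fun f hf => ?_) f hf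
  obtain ⟨g, k, hg, hk, h⟩ := hf.exists_commutator
  have : f = ⁅(⟨g, hV hg.mem_FAlt⟩ : V), ⟨k, hV hk.mem_FAlt⟩⁆ := Subtype.ext h
  rw [this, hcoe]
  exact commutator_mem_FAlt (h1 _ hg.mem_FAlt)

theorem eq_one_of_commute_FAlt [Infinite α] {g : Perm α} (h : ∀ f ∈ FAlt α, Commute g f) :
    g = 1 := by
  ext x
  by_contra hx
  rw [Perm.one_apply] at hx
  obtain ⟨y, hy⟩ := Infinite.exists_notMem_finset ({x, g x} : Finset α)
  obtain ⟨z, hz⟩ := Infinite.exists_notMem_finset ({x, g x, y} : Finset α)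
  simp only [Finset.mem_insert, Finset.mem_singleton, not_or] at hy hz
  have h1 := congrArg (fun k : Perm α => k x)
    (h (cyc x y z) (cyc_mem_FAlt (Ne.symm hy.1) (Ne.symm hz.2.2))).eq
  simp only [Perm.mul_apply] at h1
  rw [cyc_apply_fst (Ne.symm hy.1) (Ne.symm hz.1), cyc_apply_of_ne hx (Ne.symm hy.2)
    (Ne.symm hz.2.1)] at h1
  exact hy.1 (g.injective h1)

/-- Every automorphism of a group `V` of permutations that contains `FAlt`, and whose commutators
are finitary, is induced by a permutation. -/
theorem equiv_eq_conj [Infinite α] {V : Subgroup (Perm α)} (hV : FAlt α ≤ V)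
    (hcomm : ∀ x ∈ V, ∀ y ∈ V, ⁅x, y⁆ ∈ FSym α) (e : V ≃* V) :
    ∃ ν : Perm α, ∀ v : V, (e v : Perm α) = ν * v * ν⁻¹ := by
  let r : (V ≃* V) → FAlt α → FAlt α := fun e f =>
    ⟨e ⟨f, hV f.2⟩, map_mem_FAlt hV hcomm e (f := ⟨f, hV f.2⟩) f.2⟩
  let e' : FAlt α ≃* FAlt α :=
    { toFun := r e
      invFun := r e.symm
      left_inv := fun f => Subtype.ext (by simp [r])
      right_inv := fun f => Subtype.ext (by simp [r])
      map_mul' := fun f g => Subtype.ext (by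
        have h := congrArg (fun v : V => (v : Perm α)) (map_mul e ⟨f, hV f.2⟩ ⟨g, hV g.2⟩)
        exact h) }
  obtain ⟨ν, hν⟩ := FAlt_equiv_eq_conj e'
  have hν' : ∀ f : V, (f : Perm α) ∈ FAlt α → (e f : Perm α) = ν * f * ν⁻¹ :=
    fun f hf => hν ⟨f, hf⟩
  refine ⟨ν, fun v => ?_⟩
  -- Both factors induce inverse conjugations on `e (FAlt) = FAlt`, whose centraliser is trivial.
  have : (ν * v * ν⁻¹)⁻¹ * (e v : Perm α) = 1 := by
    apply eq_one_of_commute_FAlt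
    intro f hf
    obtain ⟨k, hk⟩ : ∃ k : V, (k : Perm α) ∈ FAlt α ∧ (e k : Perm α) = f := by
      have h1 := hν (e'.symm ⟨f, hf⟩)
      refine ⟨⟨(e'.symm ⟨f, hf⟩ : FAlt α), hV (e'.symm ⟨f, hf⟩).2⟩, (e'.symm ⟨f, hf⟩).2, ?_⟩
      have h2 : ((e' (e'.symm ⟨f, hf⟩) : FAlt α) : Perm α) = f := by
        rw [MulEquiv.apply_symm_apply]
      exact h2
    have h1 := hν' (v * k * v⁻¹) ((FAlt_normal α).conj_mem _ hk.1 _)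
    have h2 := hν' k hk.1
    rw [hk.2] at h2
    simp only [map_mul, map_inv, Subgroup.coe_mul, Subgroup.coe_inv, hk.2] at h1
    have h3 : (e v : Perm α) * f * (e v : Perm α)⁻¹ =
        (ν * v * ν⁻¹) * f * (ν * v * ν⁻¹)⁻¹ := by
      rw [h1, h2]; group
    have h4 : (e v : Perm α) * f = (ν * v * ν⁻¹) * f * ((ν * v * ν⁻¹)⁻¹ * (e v : Perm α)) := by
      rw [← mul_assoc, ← h3]; group
    rw [Commute, SemiconjBy, mul_assoc, h4]
    group
  exact (inv_mul_eq_one.1 this).symm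

end Automorphisms

/-! ### Translation lengths, shifts, and commutators in `H` modulo `FAlt`. -/

section Translations

open Equiv Equiv.Perm
open scoped commutatorElement

variable {n : ℕ}

theorem EventualTranslation.unique {g : Perm (X n)} {i : Fin n} {s t : ℤ}
    (hs : EventualTranslation g i s) (ht : EventualTranslation g i t) : s = t := by
  obtain ⟨z, hz⟩ := hs
  obtain ⟨w, hw⟩ := ht
  have h1 := (hz (z + w) (by omega)).2
  have h2 := (hw (z + w) (by omega)).2
  omega

open scoped Classical in
/-- The eventual translation length `t_i(g)` of `g` on the `i`-th ray. -/
noncomputable def trans (g : Perm (X n)) (i : Fin n) : ℤ :=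
  if h : ∃ t, EventualTranslation g i t then h.choose else 0

theorem EventualTranslation.trans_eq {g : Perm (X n)} {i : Fin n} {t : ℤ}
    (h : EventualTranslation g i t) : trans g i = t := by
  have h' : ∃ t, EventualTranslation g i t := ⟨t, h⟩
  rw [trans, dif_pos h']
  exact h'.choose_spec.unique h

theorem eventualTranslation_trans {g : Perm (X n)} (hg : g ∈ H n) (i : Fin n) :
    EventualTranslation g i (trans g i) := by
  obtain ⟨t, ht⟩ := hg i
  rwa [ht.trans_eq]

theorem trans_mul {g h : Perm (X n)} (hg : g ∈ H n) (hh : h ∈ H n) (i : Fin n) :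
    trans (g * h) i = trans g i + trans h i :=
  ((eventualTranslation_trans hg i).mul (eventualTranslation_trans hh i)).trans_eq

theorem trans_inv {g : Perm (X n)} (hg : g ∈ H n) (i : Fin n) :
    trans g⁻¹ i = -trans g i :=
  (eventualTranslation_trans hg i).inv.trans_eq

/-- The translation length on a ray as a homomorphism. -/
noncomputable def transHom (i : Fin n) : H n →* Multiplicative ℤ where
  toFun g := Multiplicative.ofAdd (trans (g : Perm (X n)) i)
  map_one' := by
    rw [Subgroup.coe_one, (EventualTranslation.one i).trans_eq]
    rfl
  map_mul' g h := by
    rw [Subgroup.coe_mul, trans_mul g.2 h.2]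
    rfl

theorem trans_zpow {g : Perm (X n)} (hg : g ∈ H n) (i : Fin n) (k : ℤ) :
    trans (g ^ k) i = k * trans g i := by
  have h := map_zpow (transHom i) ⟨g, hg⟩ k
  have h' := congrArg Multiplicative.toAdd h
  simpa [transHom] using h'

theorem trans_pow {g : Perm (X n)} (hg : g ∈ H n) (i : Fin n) (k : ℕ) :
    trans (g ^ k) i = k * trans g i := by
  rw [← zpow_natCast, trans_zpow hg]

theorem FSym.eventualTranslation {g : Perm (X n)} (hg : g ∈ FSym (X n)) (i : Fin n) :
    EventualTranslation g i 0 := by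
  obtain ⟨z, hz⟩ := (Set.Finite.image Prod.snd hg).bddAbove
  refine ⟨z + 1, fun m hm => ?_⟩
  have : g (i, m) = (i, m) := by
    by_contra h
    have := hz ⟨(i, m), h, rfl⟩
    simp only at this
    omega
  simp [this]

theorem FSym_le_H : FSym (X n) ≤ H n := fun _ hg i => ⟨0, FSym.eventualTranslation hg i⟩

theorem trans_eq_zero_of_mem_FSym {g : Perm (X n)} (hg : g ∈ FSym (X n)) (i : Fin n) :
    trans g i = 0 := (FSym.eventualTranslation hg i).trans_eq

theorem mem_FSym_of_trans_eq_zero {g : Perm (X n)} (hg : g ∈ H n) (h : ∀ i, trans g i = 0) :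
    g ∈ FSym (X n) := by
  have h1 : ∀ i, EventualTranslation g i 0 := fun i => h i ▸ eventualTranslation_trans hg i
  choose z hz using h1
  refine Set.Finite.subset ((Set.finite_univ (α := Fin n)).prod (Set.finite_Iio (∑ i, z i))) ?_
  rintro ⟨i, m⟩ hx
  refine ⟨trivial, ?_⟩
  by_contra hm
  have h2 : z i ≤ ∑ i, z i := Finset.single_le_sum (fun _ _ => Nat.zero_le _) (Finset.mem_univ i)
  obtain ⟨h3, h4⟩ := hz i m (by simp at hm; omega)
  exact hx (Prod.ext h3 (by simpa using h4))

theorem commutator_mem_FSym {g h : Perm (X n)} (hg : g ∈ H n) (hh : h ∈ H n) :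
    ⁅g, h⁆ ∈ FSym (X n) := by
  rw [commutatorElement_def]
  have h1 := (H n).mul_mem hg hh
  have h2 := (H n).mul_mem h1 ((H n).inv_mem hg)
  refine mem_FSym_of_trans_eq_zero ((H n).mul_mem h2 ((H n).inv_mem hh)) fun i => ?_
  rw [trans_mul h2 ((H n).inv_mem hh), trans_mul h1 ((H n).inv_mem hg), trans_mul hg hh,
    trans_inv hg, trans_inv hh]
  ring

/-- For large `Z`, `g` maps the first `Z` points of every ray bijectively onto the first `Z + t_i`
points of each ray `i`; compare cardinalities. -/
theorem sum_trans_eq_zero {g : Perm (X n)} (hg : g ∈ H n) : ∑ i, trans g i = 0 := by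
  have h1 := fun i => eventualTranslation_trans hg i
  choose z hz using h1
  set t := trans g with ht
  have hZ : ∀ i, z i + (t i).natAbs ≤ ∑ i, (z i + (t i).natAbs) := fun i =>
    Finset.single_le_sum (f := fun i => z i + (t i).natAbs) (fun _ _ => Nat.zero_le _)
      (Finset.mem_univ i)
  set Z := ∑ i, (z i + (t i).natAbs) with hZdef
  have hcard : (Finset.univ ×ˢ Finset.range Z : Finset (X n)).card =
      (Finset.univ.sigma fun i : Fin n => Finset.range (Z + t i).toNat).card := by
    refine Finset.card_nbij' (fun x => ⟨(g x).1, (g x).2⟩) (fun y => g⁻¹ (y.1, y.2)) ?_ ?_ ?_ ?_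
    · intro x hx
      simp only [Finset.coe_product, Finset.coe_univ, Finset.coe_range, Set.mem_prod, Set.mem_univ,
        Set.mem_Iio, true_and] at hx
      simp only [Finset.coe_sigma, Finset.coe_univ, Set.mem_sigma_iff, Set.mem_univ, true_and,
        Finset.coe_range, Set.mem_Iio]
      by_contra hc
      have h2 := hZ (g x).1
      obtain ⟨h3, h4⟩ := hz (g x).1 ((g x).2 - t (g x).1).toNat (by omega)
      have h5 : g ((g x).1, ((g x).2 - t (g x).1).toNat) = g x :=
        Prod.ext h3 (by zify; rw [h4]; omega)
      have h6 := congrArg Prod.snd (g.injective h5)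
      simp only at h6
      omega
    · rintro ⟨i, m⟩ hy
      simp only [Finset.coe_product, Finset.coe_univ, Finset.coe_range, Set.mem_prod, Set.mem_univ,
        Set.mem_Iio, true_and]
      simp only [Finset.coe_sigma, Finset.coe_univ, Set.mem_sigma_iff, Set.mem_univ, true_and,
        Finset.coe_range, Set.mem_Iio] at hy
      by_contra hc
      obtain ⟨y, hy'⟩ : ∃ y, g⁻¹ (i, m) = y := ⟨_, rfl⟩
      rw [hy'] at hc
      have hgy : g y = (i, m) := by rw [← hy']; simp
      have h2 := hZ y.1
      obtain ⟨h3, h4⟩ := hz y.1 y.2 (by omega)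
      rw [Prod.mk.eta, hgy] at h3 h4
      simp only at h3 h4
      subst h3
      omega
    · intro x _
      simp
    · rintro ⟨i, m⟩ _
      simp
  rw [Finset.card_product, Finset.card_univ, Fintype.card_fin, Finset.card_range,
    Finset.card_sigma] at hcard
  simp only [Finset.card_range] at hcard
  have h2 : ((n * Z : ℕ) : ℤ) = ∑ i, (Z + t i) := by
    rw [hcard, Nat.cast_sum]
    refine Finset.sum_congr rfl fun i _ => ?_
    have := hZ i
    omega
  rw [Finset.sum_add_distrib] at h2
  simp at h2
  exact h2

theorem shift_apply (a b : Fin n) (h : a ≠ b) (x : X n) : shift a b h x = shiftFun a b x := rfl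

theorem shift_eventualTranslation (a b : Fin n) (h : a ≠ b) (i : Fin n) :
    EventualTranslation (shift a b h) i ((if i = a then 1 else 0) - (if i = b then 1 else 0)) := by
  refine ⟨1, fun m hm => ?_⟩
  rw [shift_apply, shiftFun]
  by_cases ha : i = a
  · subst ha
    simp [h]
  by_cases hb : i = b
  · subst hb
    have : m ≠ 0 := by omega
    simp [ha, this]
    omega
  simp [ha, hb]

theorem shift_mem_H (a b : Fin n) (h : a ≠ b) : shift a b h ∈ H n :=
  fun i => ⟨_, shift_eventualTranslation a b h i⟩

theorem trans_shift (a b : Fin n) (h : a ≠ b) (i : Fin n) :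
    trans (shift a b h) i = (if i = a then 1 else 0) - (if i = b then 1 else 0) :=
  (shift_eventualTranslation a b h i).trans_eq

/-- Elements of `H_n` whose translation lengths are divisible by `p` are obtained from finitary
permutations by multiplication with `p`-th powers of shifts. -/
theorem H_induction (o : Fin n) (p : ℕ) {P : Perm (X n) → Prop} (hF : ∀ f ∈ FSym (X n), P f)
    (hstep : ∀ g ∈ H n, ∀ (i : Fin n) (h : o ≠ i) (k : ℤ), P g → P (g * (shift o i h ^ p) ^ k))
    {g : Perm (X n)} (hg : g ∈ H n) (hp : ∀ i, (p : ℤ) ∣ trans g i) : P g := by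
  -- Induction on a set of rays outside which, except for `o`, all lengths vanish. When it is empty,
  -- the zero sum makes the length on `o` vanish as well.
  suffices key : ∀ (s : Finset (Fin n)) (g : Perm (X n)), g ∈ H n → (∀ i, (p : ℤ) ∣ trans g i) →
      (∀ i, i ∉ s → i ≠ o → trans g i = 0) → P g from
    key Finset.univ g hg hp fun i hi => absurd (Finset.mem_univ i) hi
  intro s
  induction s using Finset.induction with
  | empty =>
    intro g hg _ h0
    refine hF g (mem_FSym_of_trans_eq_zero hg fun i => ?_)
    by_cases hi : i = o
    · subst hi
      rw [← sum_trans_eq_zero hg]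
      exact (Finset.sum_eq_single i (fun j _ hj => h0 j (by simp) hj) (by simp)).symm
    · exact h0 i (by simp) hi
  | insert i s his ih =>
    intro g hg hp h0
    by_cases hi : o = i
    · subst hi
      exact ih g hg hp fun j hj hjo => h0 j (by simp [hj, hjo]) hjo
    obtain ⟨k, hk⟩ := hp i
    have hs : shift o i hi ^ p ∈ H n := (H n).pow_mem (shift_mem_H o i hi) p
    have hs' : (shift o i hi ^ p) ^ k ∈ H n := (H n).zpow_mem hs k
    have ht : ∀ j, trans ((shift o i hi ^ p) ^ k) j =
        p * k * ((if j = o then 1 else 0) - (if j = i then 1 else 0)) := fun j => by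
      rw [trans_zpow hs, trans_pow (shift_mem_H o i hi), trans_shift]
      ring
    -- The shift has length `-1` on ray `i`, so this factor cancels the length `p * k` there.
    have hP : P (g * (shift o i hi ^ p) ^ k) := by
      refine ih _ ((H n).mul_mem hg hs') (fun j => ?_) (fun j hj hjo => ?_)
      · rw [trans_mul hg hs', ht, mul_assoc]
        exact dvd_add (hp j) (dvd_mul_right _ _)
      · rw [trans_mul hg hs', ht]
        by_cases hji : j = i
        · subst hji
          simp [hjo, hk]
        · simp [hjo, hji, h0 j (by simp [hji, hj]) hjo]
    have h2 := hstep _ ((H n).mul_mem hg hs') i hi (-k) hP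
    rwa [zpow_neg, mul_inv_cancel_right] at h2

/-- Both products push the first points of the rays `i` and `j` onto the first two places of `o`, in
opposite orders. -/
theorem shift_mul_shift {o i j : Fin n} (hi : o ≠ i) (hj : o ≠ j) (hij : i ≠ j) :
    shift o i hi * shift o j hj =
      swap ((o, 0) : X n) (o, 1) * (shift o j hj * shift o i hi) := by
  ext1 ⟨k, m⟩
  simp only [Perm.mul_apply, shift_apply]
  by_cases h1 : k = o
  · subst h1
    have h2 : swap ((k, 0) : X n) (k, 1) (k, m + 2) = (k, m + 2) :=
      swap_apply_of_ne_of_ne (by simp) (by simp)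
    simp [shiftFun, h2]
  by_cases h2 : k = i
  · subst h2
    by_cases hm : m = 0
    · subst hm
      simp [shiftFun, h1, hij]
    · have h3 : swap ((o, 0) : X n) (o, 1) (k, m - 1) = (k, m - 1) :=
        swap_apply_of_ne_of_ne (by simp [h1]) (by simp [h1])
      simp [shiftFun, h1, hij, hm, h3]
  by_cases h3 : k = j
  · subst h3
    by_cases hm : m = 0
    · subst hm
      simp [shiftFun, h1, h2]
    · have h3 : swap ((o, 0) : X n) (o, 1) (k, m - 1) = (k, m - 1) :=
        swap_apply_of_ne_of_ne (by simp [h1]) (by simp [h1])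
      simp [shiftFun, h1, h2, hm, h3]
  have h4 : swap ((o, 0) : X n) (o, 1) (k, m) = (k, m) :=
    swap_apply_of_ne_of_ne (by simp [h1]) (by simp [h1])
  simp [shiftFun, h1, h2, h3, h4]

theorem commutator_mul_left_of_central {Q : Type*} [Group Q] {z a b c : Q} {k l : ℤ}
    (hz : ∀ x, Commute z x) (ha : ⁅a, c⁆ = z ^ k) (hb : ⁅b, c⁆ = z ^ l) :
    ⁅a * b, c⁆ = z ^ (k + l) := by
  have h : ⁅a * b, c⁆ = a * ⁅b, c⁆ * a⁻¹ * ⁅a, c⁆ := by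
    simp only [commutatorElement_def]; group
  rw [h, hb, ha, ← ((hz a).zpow_left l).eq, mul_inv_cancel_right, ← zpow_add, add_comm]

theorem commutator_inv_left_of_central {Q : Type*} [Group Q] {z a c : Q} {k : ℤ}
    (hz : ∀ x, Commute z x) (ha : ⁅a, c⁆ = z ^ k) : ⁅a⁻¹, c⁆ = z ^ (-k) := by
  have h : ⁅a⁻¹, c⁆ = a⁻¹ * ⁅a, c⁆⁻¹ * a := by
    simp only [commutatorElement_def]; group
  rw [h, ha, ← zpow_neg, mul_assoc, ((hz a).zpow_left (-k)).eq, inv_mul_cancel_left]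

/-- The elements `g` of `H_n` whose commutator with `h` has the parity of `∑ t_i(g) t_i(h)`. -/
noncomputable def paritySubgroup (o : Fin n) (h : Perm (X n)) : Subgroup (Perm (X n)) where
  carrier := {g | g ∈ H n ∧ ⁅QuotientGroup.mk' (FAlt (X n)) g, QuotientGroup.mk' (FAlt (X n)) h⁆ =
    QuotientGroup.mk' (FAlt (X n)) (swap (o, 0) (o, 1)) ^ (∑ i, trans g i * trans h i)}
  one_mem' := by
    refine ⟨(H n).one_mem, ?_⟩
    simp [(EventualTranslation.one _).trans_eq]
  mul_mem' := by
    rintro a b ⟨ha, ha'⟩ ⟨hb, hb'⟩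
    refine ⟨(H n).mul_mem ha hb, ?_⟩
    rw [map_mul, commutator_mul_left_of_central (mk_swap_comm (by simp)) ha' hb',
      ← Finset.sum_add_distrib]
    simp only [trans_mul ha hb, add_mul]
    rfl
  inv_mem' := by
    rintro a ⟨ha, ha'⟩
    refine ⟨(H n).inv_mem ha, ?_⟩
    rw [map_inv, commutator_inv_left_of_central (mk_swap_comm (by simp)) ha',
      ← Finset.sum_neg_distrib]
    simp only [trans_inv ha, neg_mul]
    rfl

/-- Exchanging the entries inverts the commutator, which changes nothing for values in a group of
order at most 2. This permits reduction to generators in both entries. -/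
theorem mem_paritySubgroup_symm {o : Fin n} {g h : Perm (X n)} (hh : h ∈ H n)
    (hg : g ∈ paritySubgroup o h) : h ∈ paritySubgroup o g := by
  refine ⟨hh, ?_⟩
  have hsq : (QuotientGroup.mk' (FAlt (X n)) (swap (o, 0) (o, 1))) *
      QuotientGroup.mk' (FAlt (X n)) (swap (o, 0) (o, 1)) = 1 := by
    rw [← sq]; exact mk_swap_sq
  rw [← commutatorElement_inv, hg.2, ← inv_zpow, inv_eq_of_mul_eq_one_right hsq]
  simp only [mul_comm]

theorem FSym_le_paritySubgroup (o : Fin n) (h : Perm (X n)) :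
    FSym (X n) ≤ paritySubgroup o h := by
  intro f hf
  refine ⟨FSym_le_H hf, ?_⟩
  rw [← map_commutatorElement]
  simp only [trans_eq_zero_of_mem_FSym hf, zero_mul, Finset.sum_const_zero, zpow_zero]
  exact (QuotientGroup.eq_one_iff _).2 (commutator_mem_FAlt hf)

theorem H_le_of_shift_mem {K : Subgroup (Perm (X n))} (o : Fin n) (hF : FSym (X n) ≤ K)
    (hs : ∀ i (h : o ≠ i), shift o i h ∈ K) : H n ≤ K := fun _ hg =>
  H_induction o 1 hF
    (fun _ _ i h k hP => K.mul_mem hP (K.zpow_mem (K.pow_mem (hs i h) 1) k)) hg (by simp)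

theorem shift_mem_paritySubgroup {o i j : Fin n} (hi : o ≠ i) (hj : o ≠ j) :
    shift o i hi ∈ paritySubgroup o (shift o j hj) := by
  refine ⟨shift_mem_H o i hi, ?_⟩
  rw [← map_commutatorElement]
  simp only [trans_shift, sub_mul, mul_sub, ite_mul, one_mul, zero_mul]
  -- For `i = j` the commutator is trivial and the sum is 2; otherwise only ray `o` contributes, and
  -- the commutator is the transposition itself.
  by_cases hij : i = j
  · subst hij
    have h2 : (QuotientGroup.mk' (FAlt (X n)) (swap (o, 0) (o, 1))) ^ (2 : ℤ) = 1 := by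
      exact_mod_cast mk_swap_sq
    simpa [Finset.sum_sub_distrib, hi, hi.symm] using h2.symm
  · have h2 : ⁅shift o i hi, shift o j hj⁆ = swap ((o, 0) : X n) (o, 1) := by
      rw [commutatorElement_def, shift_mul_shift hi hj hij]
      group
    rw [h2]
    simp [Finset.sum_sub_distrib, hi.symm, hj, hij]

theorem H_le_paritySubgroup (o : Fin n) {h : Perm (X n)} (hh : h ∈ H n) :
    H n ≤ paritySubgroup o h :=
  H_le_of_shift_mem o (FSym_le_paritySubgroup o h) fun _ hi =>
    mem_paritySubgroup_symm (shift_mem_H o _ hi)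
      (H_le_of_shift_mem o (FSym_le_paritySubgroup o _)
        (fun _ hj => shift_mem_paritySubgroup hj hi) hh)

theorem commutator_mem_FAlt_of_even {g h : Perm (X n)} (hg : g ∈ H n) (hh : h ∈ H n)
    (he : Even (∑ i, trans g i * trans h i)) : ⁅g, h⁆ ∈ FAlt (X n) := by
  rcases isEmpty_or_nonempty (Fin n) with _ | ⟨⟨o⟩⟩
  · rw [Subsingleton.elim ⁅g, h⁆ 1]
    exact (FAlt (X n)).one_mem
  have h1 := (H_le_paritySubgroup o hh hg).2
  obtain ⟨k, hk⟩ := he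
  rw [← QuotientGroup.eq_one_iff]
  rw [← map_commutatorElement, hk, ← two_mul, zpow_mul] at h1
  have h2 : (QuotientGroup.mk' (FAlt (X n)) (swap (o, 0) (o, 1))) ^ (2 : ℤ) = 1 := by
    exact_mod_cast mk_swap_sq
  rw [h2, one_zpow] at h1
  exact h1

/-- Squaring a product costs one factor `z`; the squares of `G` and `S` commute, so squaring once
more costs `z ^ 2 = 1`. -/
theorem mul_pow_four_of_central {Q : Type*} [Group Q] {z G S : Q} (hc : ∀ x, Commute z x)
    (hc2 : z ^ 2 = 1) (e : S * G = z * (G * S)) : (G * S) ^ 4 = G ^ 4 * S ^ 4 := by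
  have e2 : (G * S) ^ 2 = z * (G ^ 2 * S ^ 2) := by
    calc (G * S) ^ 2 = G * (S * G) * S := by rw [sq]; group
      _ = (G * z) * (G * S) * S := by rw [e]; group
      _ = z * (G ^ 2 * S ^ 2) := by rw [← (hc G).eq]; simp only [sq, mul_assoc]
  have e3 : Commute (S ^ 2) (G ^ 2) := by
    have f1 : S * G ^ 2 = G ^ 2 * S := by
      calc S * G ^ 2 = (S * G) * G := by rw [sq, mul_assoc]
        _ = z * (G * S) * G := by rw [e]
        _ = z * G * (S * G) := by simp only [mul_assoc]
        _ = z * (G * z) * (G * S) := by rw [e]; group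
        _ = z ^ 2 * G ^ 2 * S := by rw [← (hc G).eq]; simp only [sq, mul_assoc]
        _ = G ^ 2 * S := by rw [hc2, one_mul]
    exact Commute.pow_left f1 2
  calc (G * S) ^ 4 = ((G * S) ^ 2) ^ 2 := by rw [← pow_mul]
    _ = z ^ 2 * (G ^ 2 * S ^ 2) ^ 2 := by rw [e2, (hc _).mul_pow]
    _ = G ^ 4 * S ^ 4 := by
      rw [hc2, one_mul, e3.symm.mul_pow, ← pow_mul, ← pow_mul]

theorem shift_pow_mem_U [NeZero n] (p : ℕ) {i : Fin n} (hi : 0 ≠ i) :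
    shift 0 i hi ^ p ∈ U n p :=
  Subgroup.subset_closure (Or.inr ⟨i, hi, rfl⟩)

theorem FAlt_le_U [NeZero n] (p : ℕ) : FAlt (X n) ≤ U n p :=
  fun _ hf => Subgroup.subset_closure (Or.inl hf)

/-- If all translation lengths of `g` are divisible by `p`, then `g ^ 4` lies in `U_{4p}`. -/
theorem pow_four_mem_U [NeZero n] (p : ℕ) {g : Perm (X n)} (hg : g ∈ H n)
    (hp : ∀ i, (p : ℤ) ∣ trans g i) : g ^ 4 ∈ U n (4 * p) := by
  have hF := FAlt_le_U (n := n) (4 * p)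
  have hmk : ∀ x y : Perm (X n), (QuotientGroup.mk x : Perm (X n) ⧸ FAlt (X n)) =
      QuotientGroup.mk y → x ∈ U n (4 * p) → y ∈ U n (4 * p) := by
    intro x y hxy hx
    have := (U n (4 * p)).mul_mem hx (hF (QuotientGroup.eq.1 hxy))
    rwa [mul_inv_cancel_left] at this
  refine H_induction 0 p (P := fun g => g ^ 4 ∈ U n (4 * p)) ?_ ?_ hg hp
  · intro f hf
    apply hF
    rw [← QuotientGroup.eq_one_iff, show 4 = 2 * 2 from rfl, pow_mul, QuotientGroup.mk_pow,
      QuotientGroup.mk_pow, mk_sq_of_mem_FSym hf, one_pow]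
  · intro g hg i hi k hP
    set s := (shift 0 i hi ^ p) ^ k with hs
    have hsH : s ∈ H n := (H n).zpow_mem ((H n).pow_mem (shift_mem_H 0 i hi) p) k
    have hs4 : s ^ 4 ∈ U n (4 * p) := by
      have : s ^ 4 = (shift 0 i hi ^ (4 * p)) ^ k := by
        rw [hs, ← zpow_natCast, zpow_comm, zpow_natCast, ← pow_mul, mul_comm]
      rw [this]
      exact (U n (4 * p)).zpow_mem (shift_pow_mem_U (4 * p) hi) k
    refine hmk (g ^ 4 * s ^ 4) _ ?_ (Subgroup.mul_mem _ hP hs4)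
    have hc := mk_comm_of_mem_FSym (commutator_mem_FSym hsH hg)
    have hc2 := mk_sq_of_mem_FSym (commutator_mem_FSym hsH hg)
    have e : (QuotientGroup.mk s : Perm (X n) ⧸ FAlt (X n)) * QuotientGroup.mk g =
        QuotientGroup.mk ⁅s, g⁆ * (QuotientGroup.mk g * QuotientGroup.mk s) := by
      rw [← QuotientGroup.mk_mul, ← QuotientGroup.mk_mul, ← QuotientGroup.mk_mul]
      congr 1
      rw [commutatorElement_def]
      group
    simp only [QuotientGroup.mk_mul, QuotientGroup.mk_pow]
    exact (mul_pow_four_of_central hc hc2 e).symm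

end Translations

/-! ### Subgroups of finite index, refined rays, and the normaliser. -/

section FiniteIndex

open Equiv Equiv.Perm
open scoped commutatorElement

theorem exists_mem_FSym_apply {α : Type*} [DecidableEq α] {a b c a' b' c' : α} (hab : a ≠ b)
    (hac : a ≠ c) (hbc : b ≠ c) (hab' : a' ≠ b') (hac' : a' ≠ c') (hbc' : b' ≠ c') :
    ∃ g ∈ FSym α, g a = a' ∧ g b = b' ∧ g c = c' := by
  obtain ⟨g₁, hg₁, ha₁⟩ : ∃ g ∈ FSym α, g a = a' :=
    ⟨swap a a', swap_mem_FSym a a', swap_apply_left a a'⟩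
  obtain ⟨g₂, hg₂, ha₂, hb₂⟩ : ∃ g ∈ FSym α, g a = a' ∧ g b = b' := by
    refine ⟨swap (g₁ b) b' * g₁, (FSym α).mul_mem (swap_mem_FSym _ _) hg₁, ?_, ?_⟩
    · rw [Perm.mul_apply, ha₁]
      exact swap_apply_of_ne_of_ne (by rw [← ha₁]; exact g₁.injective.ne hab) hab'
    · rw [Perm.mul_apply, swap_apply_left]
  refine ⟨swap (g₂ c) c' * g₂, (FSym α).mul_mem (swap_mem_FSym _ _) hg₂, ?_, ?_, ?_⟩
  · rw [Perm.mul_apply, ha₂]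
    exact swap_apply_of_ne_of_ne (by rw [← ha₂]; exact g₂.injective.ne hac) hac'
  · rw [Perm.mul_apply, hb₂]
    exact swap_apply_of_ne_of_ne (by rw [← hb₂]; exact g₂.injective.ne hbc) hbc'
  · rw [Perm.mul_apply, swap_apply_left]

/-- A subgroup of finite index in a group that contains `FSym` contains `FAlt`. -/
theorem FAlt_le_of_finiteIndex {α : Type*} [Infinite α] {G V : Subgroup (Perm α)}
    (hG : FSym α ≤ G) (hfin : (V.subgroupOf G).FiniteIndex) : FAlt α ≤ V := by
  classical
  let N := (V.subgroupOf G).normalCore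
  have hN : ∀ x : G, x ∈ N → (x : Perm α) ∈ V := fun x hx =>
    Subgroup.mem_subgroupOf.1 ((V.subgroupOf G).normalCore_le hx)
  let x := Infinite.natEmbedding α
  have hx : ∀ {i j : ℕ}, i ≠ j → x i ≠ x j := fun h => x.injective.ne h
  -- Infinitely many transpositions through `x 0`, finitely many cosets: two agree modulo `N`. As
  -- `N` is normal and `FSym` is 3-transitive, all products of two transpositions sharing one point
  -- follow.
  let f : ℕ → G ⧸ N := fun k => QuotientGroup.mk ⟨swap (x 0) (x (k + 1)), hG (swap_mem_FSym _ _)⟩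
  obtain ⟨i, j, hij, hf⟩ := Finite.exists_ne_map_eq_of_infinite f
  have hmem := QuotientGroup.eq.1 hf
  have key : ∀ a b c : α, a ≠ b → a ≠ c → b ≠ c → swap a b * swap a c ∈ V := by
    intro a b c hab hac hbc
    obtain ⟨g, hg, rfl, rfl, rfl⟩ := exists_mem_FSym_apply (a := x 0) (b := x (i + 1))
      (c := x (j + 1)) (hx (by omega)) (hx (by omega)) (hx (by omega)) hab hac hbc
    have h := hN _ ((Subgroup.normalCore_normal (V.subgroupOf G)).conj_mem _ hmem ⟨g, hG hg⟩)
    simp only [Subgroup.coe_mul, Subgroup.coe_inv, swap_inv] at h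
    rw [swap_apply_apply, swap_apply_apply]
    convert h using 1
    group
  have key' : ∀ a b c : α, a ≠ b → a ≠ c → swap a b * swap a c ∈ V := by
    intro a b c hab hac
    by_cases hbc : b = c
    · subst hbc
      rw [swap_mul_self]
      exact V.one_mem
    · exact key a b c hab hac hbc
  refine FAlt_le_of_swap_mul_swap_mem fun a b c d hab hcd => ?_
  by_cases hac : a = c
  · subst hac
    exact key' a b d hab hcd
  · have h := V.mul_mem (key' a b c hab hac) (key' c a d (Ne.symm hac) hcd)
    rwa [swap_comm c a, mul_assoc, swap_mul_self_mul] at h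

variable {n : ℕ}

theorem exists_shift_pow_mem {V : Subgroup (Perm (X n))}
    (hfin : (V.subgroupOf (H n)).FiniteIndex) :
    ∃ p : ℕ, 0 < p ∧ ∀ (a b : Fin n) (h : a ≠ b), shift a b h ^ p ∈ V := by
  -- `V` need not be normal: only some positive power with exponent at most the index is sure to lie
  -- in `V`, and the factorial is a multiple of every such exponent.
  refine ⟨((V.subgroupOf (H n)).index).factorial, Nat.factorial_pos _, fun a b h => ?_⟩
  have := Subgroup.pow_mem_of_index_ne_zero_of_dvd hfin.index_ne_zero
    (⟨shift a b h, shift_mem_H a b h⟩ : H n) (n := ((V.subgroupOf (H n)).index).factorial)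
    (fun m h1 h2 => Nat.dvd_factorial h1 h2)
  exact this

variable {V : Subgroup (Perm (X n))}

/-- A second ray supplies a shift whose `p`-th power has length `p` on ray `i`, so the infimum is
over a nonempty set and is attained. -/
theorem T_spec (hn : 2 ≤ n) {p : ℕ} (hp : 0 < p)
    (hs : ∀ (a b : Fin n) (h : a ≠ b), shift a b h ^ p ∈ V) (i : Fin n) :
    0 < T V i ∧ ∃ u ∈ V, EventualTranslation u i (T V i) := by
  have : Nontrivial (Fin n) := Fin.nontrivial_iff_two_le.2 hn
  obtain ⟨j, hj⟩ := exists_ne i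
  refine Nat.sInf_mem (s := {k : ℕ | 0 < k ∧ ∃ u ∈ V, EventualTranslation u i k})
    ⟨p, hp, _, hs i j hj.symm, ?_⟩
  have h := eventualTranslation_trans
    ((H n).pow_mem (shift_mem_H i j hj.symm) p) i
  rwa [trans_pow (shift_mem_H i j hj.symm), trans_shift, if_pos rfl, if_neg hj.symm, sub_zero,
    mul_one] at h

theorem T_dvd_trans (hV : V ≤ H n) {i : Fin n} (hT : 0 < T V i)
    (hu : ∃ u ∈ V, EventualTranslation u i (T V i)) {u : Perm (X n)} (huV : u ∈ V) :
    (T V i : ℤ) ∣ trans u i := by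
  obtain ⟨v, hv, ht⟩ := hu
  by_contra hd
  have hT' : (0 : ℤ) < T V i := by exact_mod_cast hT
  have h1 : 0 < trans u i % T V i :=
    lt_of_le_of_ne (Int.emod_nonneg _ hT'.ne') fun h => hd (Int.dvd_of_emod_eq_zero h.symm)
  have h2 := Int.emod_lt_of_pos (trans u i) hT'
  have h3 : trans (u * v ^ (-(trans u i / T V i))) i = trans u i % T V i := by
    rw [trans_mul (hV huV) ((H n).zpow_mem (hV hv) _), trans_zpow (hV hv), ht.trans_eq]
    have := Int.emod_add_mul_ediv (trans u i) (T V i)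
    linarith
  have hmem : u * v ^ (-(trans u i / T V i)) ∈ V := V.mul_mem huV (V.zpow_mem hv _)
  have h4 : T V i ≤ (trans u i % T V i).toNat :=
    Nat.sInf_le ⟨by omega, _, hmem, by
      rw [Int.toNat_of_nonneg h1.le, ← h3]
      exact eventualTranslation_trans (hV hmem) i⟩
  omega

theorem permCongrHom_mem_FSym {α β : Type*} (e : α ≃ β) {f : Perm α} (hf : f ∈ FSym α) :
    e.permCongrHom f ∈ FSym β := by
  refine Set.Finite.subset (Set.Finite.image e hf) fun y hy => ⟨e.symm y, fun h => hy ?_, by simp⟩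
  simp [Equiv.permCongrHom, Equiv.permCongr_apply, h]

theorem permCongrHom_mem_FAlt {α β : Type*} (e : α ≃ β) {f : Perm α} (hf : f ∈ FAlt α) :
    e.permCongrHom f ∈ FAlt β := by
  classical
  have h : FAlt α ≤ (FAlt β).comap e.permCongrHom.toMonoidHom := by
    refine FAlt_le_of_swap_mul_swap_mem fun a b c d hab hcd => ?_
    have h1 : ∀ a b, e.permCongrHom (swap a b) = swap (e a) (e b) := fun a b => by
      rw [Equiv.permCongrHom_coe, Equiv.permCongr_def, Equiv.symm_trans_swap_trans]
    have h2 := swap_mul_swap_mem_FAlt (e.injective.ne hab) (e.injective.ne hcd)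
    rw [← h1, ← h1, ← map_mul] at h2
    exact h2
  exact h hf

section Refine

variable {r : Fin n → ℕ} {hr : ∀ i, 0 < r i}

theorem refineRays_apply (i : Fin n) (d : Fin (r i)) (k : ℕ) :
    refineRays r hr (i, d + r i * k) = (finSigmaFinEquiv ⟨i, d⟩, k) := by
  rw [← Equiv.eq_symm_apply]
  simp [refineRays, splitRays]

/-- A translation by a multiple `r i * q` preserves residue classes modulo `r i` and moves `q` steps
within each. -/
theorem refineRays_eventualTranslation {u : Perm (X n)} {i : Fin n} {q : ℤ}
    (hu : EventualTranslation u i (r i * q)) (d : Fin (r i)) :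
    EventualTranslation ((refineRays r hr).permCongrHom u) (finSigmaFinEquiv ⟨i, d⟩) q := by
  obtain ⟨z, hz⟩ := hu
  refine ⟨z + q.natAbs, fun m hm => ?_⟩
  have hpos := hr i
  have h0 : m ≤ r i * m := Nat.le_mul_of_pos_left m hpos
  obtain ⟨h1, h2⟩ := hz (d + r i * m) (by omega)
  have h3 : u (i, d + r i * m) = (i, d + r i * (m + q).toNat) := by
    refine Prod.ext h1 ?_
    zify
    rw [h2, Int.toNat_of_nonneg (by omega)]
    push_cast
    ring
  have h4 : (refineRays r hr).permCongrHom u (finSigmaFinEquiv ⟨i, d⟩, m) =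
      (finSigmaFinEquiv ⟨i, d⟩, (m + q).toNat) := by
    rw [Equiv.permCongrHom_coe, Equiv.permCongr_apply, ← refineRays_apply (hr := hr) i d m,
      Equiv.symm_apply_apply, h3, refineRays_apply]
  rw [h4]
  refine ⟨rfl, ?_⟩
  simp only
  omega

end Refine

/-- An infinite forward orbit of an element of `H_n` ends as an arithmetic progression in one
ray. -/
theorem exists_progression_of_orbit {w : Perm (X n)} (hw : w ∈ H n) {f : ℕ → X n}
    (hf : Function.Injective f) (hfw : ∀ j, f (j + 1) = w (f j)) :
    ∃ (k : Fin n) (c s J : ℕ), 0 < s ∧ ∀ j, f (J + j) = (k, c + s * j) := by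
  choose z hz using fun i => eventualTranslation_trans hw i
  have hfin : {j | (f j).2 < ∑ i, z i}.Finite := by
    refine Set.Finite.subset (Set.Finite.preimage hf.injOn
      ((Set.finite_univ (α := Fin n)).prod (Set.finite_Iio (∑ i, z i)))) fun j hj => ⟨trivial, hj⟩
  obtain ⟨J, hJ⟩ := hfin.bddAbove
  have hlarge : ∀ j, J < j → ∀ i, z i ≤ (f j).2 := by
    intro j hj i
    have h1 : z i ≤ ∑ i, z i := Finset.single_le_sum (fun _ _ => Nat.zero_le _) (Finset.mem_univ i)
    by_contra hc
    have := hJ (show j ∈ {j | (f j).2 < ∑ i, z i} by simp only [Set.mem_ofPred_eq]; omega)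
    omega
  set k := (f (J + 1)).1 with hk
  set c := (f (J + 1)).2 with hc
  have hstep : ∀ j : ℕ, (f (J + 1 + j)).1 = k ∧ ((f (J + 1 + j)).2 : ℤ) = c + trans w k * j := by
    intro j
    induction j with
    | zero => simp [hk, hc]
    | succ j ih =>
      obtain ⟨h1, h2⟩ := hz (f (J + 1 + j)).1 (f (J + 1 + j)).2 (hlarge _ (by omega) _)
      rw [Prod.mk.eta, ← hfw, ih.1] at h1 h2
      refine ⟨h1, ?_⟩
      rw [← add_assoc, h2, ih.2]
      push_cast
      ring
  -- Length zero would make the orbit stationary, and a negative length would give a negative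
  -- coordinate after `c + 1` steps.
  have hpos : 0 < trans w k := by
    rcases lt_trichotomy 0 (trans w k) with h | h | h
    · exact h
    · have h1 := hstep 1
      rw [← h, zero_mul, add_zero] at h1
      have h2 : f (J + 1 + 1) = f (J + 1) := Prod.ext h1.1 (by exact_mod_cast h1.2)
      have := hf h2
      omega
    · have h1 := (hstep (c + 1)).2
      push_cast at h1
      nlinarith
  refine ⟨k, c, (trans w k).toNat, J + 1, by omega, fun j => Prod.ext (hstep j).1 ?_⟩
  zify
  rw [(hstep j).2, Int.toNat_of_nonneg hpos.le]

/-- The tail of ray `k` is a forward orbit of `w`, so its image is a forward orbit of `ψ * w * ψ⁻¹`.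
-/
theorem exists_progression {ψ w : Perm (X n)} {k : Fin n} (hw : EventualTranslation w k 1)
    (hψ : ψ * w * ψ⁻¹ ∈ H n) :
    ∃ (k' : Fin n) (c s M : ℕ), 0 < s ∧ ∀ j, ψ (k, M + j) = (k', c + s * j) := by
  obtain ⟨z, hz⟩ := hw
  obtain ⟨k', c, s, J, hs, h⟩ := exists_progression_of_orbit hψ (f := fun j => ψ (k, z + j))
    (fun a b hab => by simpa using ψ.injective hab) (fun j => by
      have h1 : w (k, z + j) = (k, z + (j + 1)) := by
        obtain ⟨h2, h3⟩ := hz (z + j) (by omega)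
        refine Prod.ext h2 ?_
        simp only
        omega
      simp [h1])
  exact ⟨k', c, s, z + J, hs, fun j => by rw [add_assoc]; exact h j⟩

/-- A permutation that conjugates, in both directions, elements of `H_n` of translation length
one into `H_n` permutes the rays eventually. -/
theorem exists_rayPerm_mul {ψ : Perm (X n)}
    (h₁ : ∀ k, ∃ w, EventualTranslation w k 1 ∧ ψ * w * ψ⁻¹ ∈ H n)
    (h₂ : ∀ k, ∃ w, EventualTranslation w k 1 ∧ ψ⁻¹ * w * ψ⁻¹⁻¹ ∈ H n) :
    ∃ π : Perm (Fin n), ∃ h ∈ H n, ψ = rayPerm n π * h := by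
  have key : ∀ k, ∃ (k' : Fin n) (c M : ℕ), ∀ j, ψ (k, M + j) = (k', c + j) := by
    intro k
    obtain ⟨w, hw, hwH⟩ := h₁ k
    obtain ⟨k', c, s, M, hs, h⟩ := exists_progression hw hwH
    obtain ⟨w', hw', hwH'⟩ := h₂ k'
    obtain ⟨k'', c', s', M', hs', h'⟩ := exists_progression hw' hwH'
    have hle : M' ≤ s * M' := Nat.le_mul_of_pos_left M' hs
    obtain ⟨A, hA⟩ : ∃ A, c + s * M' = M' + A := ⟨c + s * M' - M', by omega⟩
    -- Going out by `ψ` and back by `ψ⁻¹` is the identity; comparing two consecutive points yields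
    -- `s' * s = 1`.
    have e : ∀ i j, c + s * i = M' + j → c' + s' * j = M + i := by
      intro i j hij
      have h3 : ψ (k, M + i) = (k', M' + j) := by rw [h i, hij]
      have h4 := h' j
      rw [← h3, Perm.inv_def, Equiv.symm_apply_apply] at h4
      exact (congrArg Prod.snd h4).symm
    have e1 := e M' A hA
    have e2 := e (M' + 1) (A + s) (by rw [mul_add, ← add_assoc, hA]; ring)
    have e3 : s' * s = 1 := by
      rw [mul_add] at e2
      omega
    have hs1 : s = 1 := Nat.eq_one_of_mul_eq_one_left e3
    exact ⟨k', c, M, fun j => by rw [h j, hs1, one_mul]⟩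
  choose π c M hπ using key
  -- Tails of two rays sent to tails of the same ray would overlap, at the point with number `c k +
  -- c l`.
  have hinj : Function.Injective π := by
    intro k l hkl
    have h3 : ψ (k, M k + c l) = ψ (l, M l + c k) := by
      rw [hπ, hπ, hkl, add_comm]
    exact congrArg Prod.fst (ψ.injective h3)
  let σ : Perm (Fin n) := Equiv.ofBijective π (Finite.injective_iff_bijective.1 hinj)
  refine ⟨σ, (rayPerm n σ)⁻¹ * ψ, fun k => ⟨(c k : ℤ) - M k, M k, fun m hm => ?_⟩,
    by rw [mul_inv_cancel_left]⟩
  obtain ⟨j, rfl⟩ := Nat.exists_eq_add_of_le hm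
  have h3 : ((rayPerm n σ)⁻¹ * ψ) (k, M k + j) = (k, c k + j) := by
    rw [Perm.mul_apply, Perm.inv_eq_iff_eq, hπ]
    rfl
  rw [h3]
  refine ⟨rfl, ?_⟩
  push_cast
  ring

theorem trans_conj {π : Perm (Fin n)} {h w : Perm (X n)} (hh : h ∈ H n) (hw : w ∈ H n)
    (k : Fin n) : trans (rayPerm n π * h * w * (rayPerm n π * h)⁻¹) (π k) = trans w k := by
  have h1 : EventualTranslation (h * w * h⁻¹) k (trans w k) := by
    have h2 := (((eventualTranslation_trans hh k).mul (eventualTranslation_trans hw k)).mul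
      (eventualTranslation_trans hh k).inv)
    rwa [add_neg_cancel_comm] at h2
  obtain ⟨z, hz⟩ := h1
  refine EventualTranslation.trans_eq ⟨z, fun m hm => ?_⟩
  have h3 : (rayPerm n π * h * w * (rayPerm n π * h)⁻¹) (π k, m) =
      rayPerm n π ((h * w * h⁻¹) (k, m)) := by
    have h4 : (rayPerm n π)⁻¹ (π k, m) = (k, m) := by
      rw [Perm.inv_eq_iff_eq]
      rfl
    simp only [mul_inv_rev, Perm.mul_apply, h4]
  obtain ⟨h5, h6⟩ := hz m hm
  rw [h3]
  exact ⟨congrArg π h5, h6⟩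

theorem card_filter_sigma_fst_eq (r : Fin n → ℕ) (i : Fin n) :
    (Finset.univ.filter fun x : Σ i, Fin (r i) => x.1 = i).card = r i := by
  have : (Finset.univ.filter fun x : Σ i, Fin (r i) => x.1 = i) =
      Finset.univ.map (Function.Embedding.sigmaMk i) := by
    ext ⟨j, d⟩
    simp only [Finset.mem_filter, Finset.mem_univ, true_and, Finset.mem_map,
      Function.Embedding.sigmaMk_apply]
    constructor
    · rintro rfl
      exact ⟨d, rfl⟩
    · rintro ⟨d', h⟩
      exact (congrArg Sigma.fst h).symm
  rw [this, Finset.card_map, Finset.card_univ, Fintype.card_fin]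

/-! ### How a normalising permutation acts on the refined rays. -/

section Normalizer

variable (hV : V ≤ H n) (hT : ∀ i, 0 < T V i)
  (hu : ∀ i, ∃ u ∈ V, EventualTranslation u i (T V i))
include hV hT hu

theorem refined_eventualTranslation {u : Perm (X n)} (huV : u ∈ V) (i : Fin n)
    (d : Fin (T V i)) : EventualTranslation ((refineRays (T V) hT).permCongrHom u)
      (finSigmaFinEquiv ⟨i, d⟩) (trans u i / T V i) := by
  apply refineRays_eventualTranslation
  rw [Int.mul_ediv_cancel' (T_dvd_trans hV (hT i) (hu i) huV)]
  exact eventualTranslation_trans (hV huV) i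

theorem refined_mem_H {u : Perm (X n)} (huV : u ∈ V) :
    (refineRays (T V) hT).permCongrHom u ∈ H (∑ i, T V i) := by
  intro k
  obtain ⟨⟨i, d⟩, rfl⟩ := finSigmaFinEquiv.surjective k
  exact ⟨_, refined_eventualTranslation hV hT hu huV i d⟩

theorem T_mul_trans_refined {u : Perm (X n)} (huV : u ∈ V) (i : Fin n) (d : Fin (T V i)) :
    T V i * trans ((refineRays (T V) hT).permCongrHom u) (finSigmaFinEquiv ⟨i, d⟩) =
      trans u i := by
  rw [(refined_eventualTranslation hV hT hu huV i d).trans_eq,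
    Int.mul_ediv_cancel' (T_dvd_trans hV (hT i) (hu i) huV)]

theorem exists_rayPerm_mul_of_mem_normalizer {ν : Perm (X n)}
    (hν : ν ∈ Subgroup.normalizer (V : Set (Perm (X n)))) :
    ∃ π : Perm (Fin (∑ i, T V i)), ∃ h ∈ H (∑ i, T V i),
      (refineRays (T V) hT).permCongrHom ν = rayPerm _ π * h := by
  have key : ∀ ν ∈ Subgroup.normalizer (V : Set (Perm (X n))), ∀ k,
      ∃ w, EventualTranslation w k 1 ∧ (refineRays (T V) hT).permCongrHom ν * w *
        ((refineRays (T V) hT).permCongrHom ν)⁻¹ ∈ H (∑ i, T V i) := by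
    intro ν hν k
    obtain ⟨⟨i, d⟩, rfl⟩ := finSigmaFinEquiv.surjective k
    obtain ⟨u, huV, hut⟩ := hu i
    refine ⟨(refineRays (T V) hT).permCongrHom u,
      refineRays_eventualTranslation (by rwa [mul_one]) d, ?_⟩
    rw [← map_inv, ← map_mul, ← map_mul]
    exact refined_mem_H hV hT hu ((Subgroup.mem_normalizer_iff.1 hν u).1 huV)
  refine exists_rayPerm_mul (key ν hν) ?_
  rw [← map_inv]
  exact key _ (inv_mem hν)

/-- The induced permutation `σ` of subrays respects the partition into original rays, hence matches
rays with equal `T`; lengths are then merely permuted. -/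
theorem dvd_trans_conj {p : ℕ} (hp : 0 < p)
    (hs : ∀ (a b : Fin n) (h : a ≠ b), shift a b h ^ p ∈ V) {ν : Perm (X n)}
    (hν : ν ∈ Subgroup.normalizer (V : Set (Perm (X n)))) {u : Perm (X n)} (huV : u ∈ V)
    (hd : ∀ i, (p : ℤ) ∣ trans u i) (j : Fin n) : (p : ℤ) ∣ trans (ν * u * ν⁻¹) j := by
  obtain ⟨π, h, hh, hπ⟩ := exists_rayPerm_mul_of_mem_normalizer hV hT hu hν
  let σ : Perm (Σ i, Fin (T V i)) := finSigmaFinEquiv.symm.permCongr π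
  have hp' : (0 : ℤ) < p := by exact_mod_cast hp
  have hT' : ∀ i, (0 : ℤ) < T V i := fun i => by exact_mod_cast hT i
  have hts : ∀ (a b : Fin n) (h : a ≠ b), trans (shift a b h ^ p) a = p ∧
      trans (shift a b h ^ p) b = -p := by
    intro a b h
    rw [trans_pow (shift_mem_H a b h), trans_pow (shift_mem_H a b h), trans_shift, trans_shift]
    simp [h, h.symm]
  have hrel : ∀ x, ∀ u ∈ V, T V x.1 * trans (ν * u * ν⁻¹) (σ x).1 =
      T V (σ x).1 * trans u x.1 := by
    rintro ⟨i, d⟩ u huV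
    have hconj := (Subgroup.mem_normalizer_iff.1 hν u).1 huV
    have e1 := T_mul_trans_refined hV hT hu huV i d
    have e2 := T_mul_trans_refined hV hT hu hconj (σ ⟨i, d⟩).1 (σ ⟨i, d⟩).2
    have e3 : finSigmaFinEquiv (⟨(σ ⟨i, d⟩).1, (σ ⟨i, d⟩).2⟩ : Σ i, Fin (T V i)) =
        π (finSigmaFinEquiv ⟨i, d⟩) := by
      simp [σ, Equiv.permCongr_apply]
    rw [e3, map_mul, map_mul, map_inv, hπ, trans_conj hh (refined_mem_H hV hT hu huV)] at e2
    rw [← e1, ← e2]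
    ring
  -- If `σ` separated two subrays of one ray, pulling back a power of a shift with lengths `p` and
  -- `-p` there would give an element both positive and negative on that ray. `hin` is the same
  -- argument pushed forward.
  have hout : ∀ x y, x.1 = y.1 → (σ x).1 = (σ y).1 := by
    intro x y hxy
    by_contra hne
    have hconj := (Subgroup.mem_normalizer_iff''.1 hν _).1 (hs _ _ hne)
    have e1 := hrel x _ hconj
    have e2 := hrel y _ hconj
    rw [show ν * (ν⁻¹ * shift (σ x).1 (σ y).1 hne ^ p * ν) * ν⁻¹ =
      shift (σ x).1 (σ y).1 hne ^ p by group] at e1 e2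
    rw [(hts _ _ hne).1] at e1
    rw [(hts _ _ hne).2, ← hxy] at e2
    generalize trans (ν⁻¹ * shift (σ x).1 (σ y).1 hne ^ p * ν) x.1 = t at e1 e2
    have h1 : 0 < t := pos_of_mul_pos_right (e1 ▸ mul_pos (hT' _) hp') (hT' _).le
    have h2 := mul_pos (hT' (σ y).1) h1
    have h3 := mul_pos (hT' x.1) hp'
    linarith
  have hin : ∀ x y, (σ x).1 = (σ y).1 → x.1 = y.1 := by
    intro x y hxy
    by_contra hne
    have e1 := hrel x _ (hs _ _ hne)
    have e2 := hrel y _ (hs _ _ hne)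
    rw [(hts _ _ hne).1] at e1
    rw [(hts _ _ hne).2, ← hxy] at e2
    generalize trans (ν * shift x.1 y.1 hne ^ p * ν⁻¹) (σ x).1 = t at e1 e2
    have h3 := mul_pos (hT' (σ x).1) hp'
    have h1 : 0 < t := pos_of_mul_pos_right (e1 ▸ h3) (hT' _).le
    have h2 := mul_pos (hT' y.1) h1
    linarith
  obtain ⟨x, hx⟩ := σ.surjective ⟨j, ⟨0, hT j⟩⟩
  have hxj : (σ x).1 = j := by rw [hx]
  -- Ray `i` has exactly `T V i` subrays, and `σ` maps those of ray `x.1` bijectively onto those of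
  -- ray `j`.
  have hTT : T V x.1 = T V j := by
    rw [← card_filter_sigma_fst_eq (T V) x.1, ← card_filter_sigma_fst_eq (T V) j]
    refine Finset.card_bijective σ σ.bijective fun y => ?_
    simp only [Finset.mem_filter, Finset.mem_univ, true_and]
    rw [← hxj]
    exact ⟨hout y x, hin y x⟩
  have e := hrel x u huV
  rw [hxj, hTT] at e
  rw [mul_left_cancel₀ (hT' j).ne' e]
  exact hd x.1

end Normalizer

theorem mem_normalizer_of_conj_mem {G : Type*} [Group G] {K : Subgroup G} {g : G}
    (h : ∀ x ∈ K, g * x * g⁻¹ ∈ K) (h' : ∀ x ∈ K, g⁻¹ * x * g ∈ K) :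
    g ∈ Subgroup.normalizer (K : Set G) := by
  refine Subgroup.mem_normalizer_iff.2 fun x => ⟨h x, fun hx => ?_⟩
  have := h' _ hx
  rwa [show g⁻¹ * (g * x * g⁻¹) * g = x by group] at this

end FiniteIndex

/-! ### The characteristic subgroup and the bounds for the refined normaliser. -/

section Main

open Equiv Equiv.Perm
open scoped commutatorElement

variable {n : ℕ} {V : Subgroup (Perm (X n))}

section Characteristic

variable (hV : V ≤ H n) (hT : ∀ i, 0 < T V i)
  (hu : ∀ i, ∃ u ∈ V, EventualTranslation u i (T V i))
include hV hT hu

/-- The conjugate of the `p`-th power of a shift still has lengths divisible by `p`, so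
`pow_four_mem_U` handles its fourth power, which is the conjugate of a generator. -/
theorem conj_mem_U [NeZero n] {p : ℕ} (hp : 0 < p)
    (hs : ∀ (a b : Fin n) (h : a ≠ b), shift a b h ^ p ∈ V) {ν : Perm (X n)}
    (hν : ν ∈ Subgroup.normalizer (V : Set (Perm (X n)))) {x : Perm (X n)}
    (hx : x ∈ U n (4 * p)) : ν * x * ν⁻¹ ∈ U n (4 * p) := by
  have h : U n (4 * p) ≤ (U n (4 * p)).comap (MulAut.conj ν).toMonoidHom := by
    refine (Subgroup.closure_le _).2 ?_
    rintro y (hy | ⟨i, hi, rfl⟩)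
    · exact FAlt_le_U _ ((FAlt_normal (X n)).conj_mem y hy ν)
    · have hd : ∀ j, (p : ℤ) ∣ trans (shift 0 i hi ^ p) j := fun j => by
        rw [trans_pow (shift_mem_H 0 i hi)]
        exact dvd_mul_right _ _
      have h1 := pow_four_mem_U p
        (hV ((Subgroup.mem_normalizer_iff.1 hν _).1 (hs 0 i hi)))
        (dvd_trans_conj hV hT hu hp hs hν (hs 0 i hi) hd)
      rw [conj_pow, ← pow_mul, mul_comm p] at h1
      exact h1
  exact h hx

theorem normalizer_le_normalizer_U [NeZero n] {p : ℕ} (hp : 0 < p)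
    (hs : ∀ (a b : Fin n) (h : a ≠ b), shift a b h ^ p ∈ V) :
    Subgroup.normalizer (V : Set (Perm (X n))) ≤
      Subgroup.normalizer (U n (4 * p) : Set (Perm (X n))) := fun ν hν =>
  mem_normalizer_of_conj_mem (fun _ hx => conj_mem_U hV hT hu hp hs hν hx) fun x hx => by
    have := conj_mem_U hV hT hu hp hs (inv_mem hν) hx
    rwa [inv_inv] at this

theorem U_characteristic [NeZero n] (hF : FAlt (X n) ≤ V) {p : ℕ} (hp : 0 < p)
    (hs : ∀ (a b : Fin n) (h : a ≠ b), shift a b h ^ p ∈ V) :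
    ((U n (4 * p)).subgroupOf V).Characteristic := by
  refine Subgroup.characteristic_iff_le_comap.2 fun e x hx => ?_
  obtain ⟨ν, hν⟩ := equiv_eq_conj hF
    (fun x hx y hy => commutator_mem_FSym (hV hx) (hV hy)) e
  have hνV : ν ∈ Subgroup.normalizer (V : Set (Perm (X n))) := by
    refine mem_normalizer_of_conj_mem (fun v hv => ?_) fun v hv => ?_
    · rw [← hν ⟨v, hv⟩]
      exact (e ⟨v, hv⟩).2
    · have h := hν (e.symm ⟨v, hv⟩)
      rw [MulEquiv.apply_symm_apply] at h
      simp only at h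
      rw [h, show ν⁻¹ * (ν * (e.symm ⟨v, hv⟩ : Perm (X n)) * ν⁻¹) * ν =
        (e.symm ⟨v, hv⟩ : Perm (X n)) by group]
      exact (e.symm ⟨v, hv⟩).2
  have h := conj_mem_U hV hT hu hp hs hνV (Subgroup.mem_subgroupOf.1 hx)
  rw [← hν x] at h
  exact h

theorem refinedNormalizer_le_HS : refinedNormalizer V hT ≤ HS (∑ i, T V i) := by
  rintro _ ⟨ν, hν, rfl⟩
  obtain ⟨π, h, hh, hπ⟩ := exists_rayPerm_mul_of_mem_normalizer hV hT hu hν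
  change (refineRays (T V) hT).permCongrHom ν ∈ _
  rw [hπ]
  exact mul_mem (Subgroup.mem_sup_right ⟨π, rfl⟩) (Subgroup.mem_sup_left hh)

end Characteristic

/-- Since `h * u * h⁻¹ = ⁅h, u⁆ * u`, only commutators need checking. -/
theorem mem_refinedNormalizer (hT : ∀ i, 0 < T V i) {h : Perm (X (∑ i, T V i))}
    (hc : ∀ u ∈ V, (refineRays (T V) hT).permCongrHom.symm
      ⁅h, (refineRays (T V) hT).permCongrHom u⁆ ∈ V)
    (hc' : ∀ u ∈ V, (refineRays (T V) hT).permCongrHom.symm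
      ⁅h⁻¹, (refineRays (T V) hT).permCongrHom u⁆ ∈ V) :
    h ∈ refinedNormalizer V hT := by
  refine ⟨(refineRays (T V) hT).permCongrHom.symm h, ?_,
    (refineRays (T V) hT).permCongrHom.apply_symm_apply h⟩
  generalize (refineRays (T V) hT).permCongrHom = Φ at *
  refine mem_normalizer_of_conj_mem (fun u hu => ?_) fun u hu => ?_
  · have h1 := V.mul_mem (hc u hu) hu
    simpa [commutatorElement_def] using h1
  · have h1 := V.mul_mem (hc' u hu) hu
    simpa [commutatorElement_def] using h1

theorem permCongrHom_symm_mem_FSym {α β : Type*} (e : α ≃ β) {f : Perm β} (hf : f ∈ FSym β) :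
    e.permCongrHom.symm f ∈ FSym α := by
  rw [Equiv.permCongrHom_symm]
  exact permCongrHom_mem_FSym e.symm hf

theorem permCongrHom_symm_mem_FAlt {α β : Type*} (e : α ≃ β) {f : Perm β} (hf : f ∈ FAlt β) :
    e.permCongrHom.symm f ∈ FAlt α := by
  rw [Equiv.permCongrHom_symm]
  exact permCongrHom_mem_FAlt e.symm hf

section Refined

variable (hV : V ≤ H n) (hT : ∀ i, 0 < T V i)
  (hu : ∀ i, ∃ u ∈ V, EventualTranslation u i (T V i))
include hV hT hu

theorem H_le_refinedNormalizer_of_FSym_le (hF : FSym (X n) ≤ V) :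
    H (∑ i, T V i) ≤ refinedNormalizer V hT := fun _ hh =>
  mem_refinedNormalizer hT
    (fun _ huV => hF (permCongrHom_symm_mem_FSym _
      (commutator_mem_FSym hh (refined_mem_H hV hT hu huV))))
    (fun _ huV => hF (permCongrHom_symm_mem_FSym _
      (commutator_mem_FSym (inv_mem hh) (refined_mem_H hV hT hu huV))))

theorem mem_refinedNormalizer_of_even (hF : FAlt (X n) ≤ V) {h : Perm (X (∑ i, T V i))}
    (hh : h ∈ H (∑ i, T V i))
    (he : ∀ u ∈ V, Even (∑ k, trans h k * trans ((refineRays (T V) hT).permCongrHom u) k)) :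
    h ∈ refinedNormalizer V hT :=
  mem_refinedNormalizer hT
    (fun u huV => hF (permCongrHom_symm_mem_FAlt _
      (commutator_mem_FAlt_of_even hh (refined_mem_H hV hT hu huV) (he u huV))))
    (fun u huV => hF (permCongrHom_symm_mem_FAlt _
      (commutator_mem_FAlt_of_even (inv_mem hh) (refined_mem_H hV hT hu huV) (by
        simp only [trans_inv hh, neg_mul, Finset.sum_neg_distrib]
        exact (he u huV).neg))))

/-- For two rays, the translation lengths of an element of `V` agree, after refinement, up to
sign. -/
theorem exists_trans_refined_eq_or_neg (hn : n = 2) {u : Perm (X n)} (huV : u ∈ V) :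
    ∃ a : ℤ, ∀ k, trans ((refineRays (T V) hT).permCongrHom u) k = a ∨
      trans ((refineRays (T V) hT).permCongrHom u) k = -a := by
  subst hn
  -- On two rays the lengths are opposite, so the minimal length on one ray also occurs, up to sign,
  -- on the other.
  have hdvd : ∀ i j : Fin 2, i ≠ j → T V i ∣ T V j := by
    intro i j hij
    obtain ⟨v, hv, hvt⟩ := hu j
    have h1 := T_dvd_trans hV (hT i) (hu i) hv
    have h2 := sum_trans_eq_zero (hV hv)
    have h3 : trans v i = -trans v j := by
      rw [Fin.sum_univ_two] at h2
      fin_cases i <;> fin_cases j <;> simp at hij ⊢ <;> omega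
    rw [h3, hvt.trans_eq, dvd_neg] at h1
    exact_mod_cast h1
  have hTT : T V 1 = T V 0 :=
    Nat.dvd_antisymm (hdvd 1 0 (by decide)) (hdvd 0 1 (by decide))
  have hT0 : (T V 0 : ℤ) ≠ 0 := by exact_mod_cast (hT 0).ne'
  refine ⟨trans u 0 / T V 0, fun k => ?_⟩
  obtain ⟨⟨i, d⟩, rfl⟩ := finSigmaFinEquiv.surjective k
  rw [(refined_eventualTranslation hV hT hu huV i d).trans_eq]
  have h2 := sum_trans_eq_zero (hV huV)
  rw [Fin.sum_univ_two] at h2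
  fin_cases i
  · exact Or.inl rfl
  · right
    have h3 : trans u 1 = -trans u 0 := by omega
    change trans u 1 / (T V 1 : ℤ) = _
    rw [h3, hTT, Int.neg_ediv_of_dvd (T_dvd_trans hV (hT 0) (hu 0) huV)]

theorem H_le_refinedNormalizer_of_two (hn : n = 2) (hF : FAlt (X n) ≤ V) :
    H (∑ i, T V i) ≤ refinedNormalizer V hT := by
  intro h hh
  refine mem_refinedNormalizer_of_even hV hT hu hF hh fun u huV => ?_
  obtain ⟨a, ha⟩ := exists_trans_refined_eq_or_neg hV hT hu hn huV
  -- Subtracting the constant `a` is free because the lengths of `h` sum to zero; each difference is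
  -- then `0` or `-2 * a`.
  have h1 : ∑ k, trans h k * trans ((refineRays (T V) hT).permCongrHom u) k =
      ∑ k, trans h k * (trans ((refineRays (T V) hT).permCongrHom u) k - a) := by
    simp only [mul_sub, Finset.sum_sub_distrib, ← Finset.sum_mul, sum_trans_eq_zero hh, zero_mul,
      sub_zero]
  rw [h1]
  refine Finset.even_sum _ fun k _ => Even.mul_left ?_ _
  rcases ha k with h2 | h2 <;> rw [h2]
  · simp
  · exact ⟨-a, by ring⟩

end Refined

end Main

end Houghton

theorem mainTheorem6 (n : ℕ) [NeZero n] (hn : 2 ≤ n)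
    (V : Subgroup (Equiv.Perm (Houghton.X n))) (hV : V ≤ Houghton.H n)
    (hfin : (V.subgroupOf (Houghton.H n)).FiniteIndex) :
    (∃ m : ℕ, 0 < m ∧ Houghton.U n m ≤ V ∧
      Subgroup.normalizer (V : Set (Equiv.Perm (Houghton.X n))) ≤
        Subgroup.normalizer (Houghton.U n m : Set (Equiv.Perm (Houghton.X n))) ∧
      ((Houghton.U n m).subgroupOf V).Characteristic) ∧
    ∃ hT : ∀ i, 0 < Houghton.T V i,
      Houghton.refinedNormalizer V hT ≤ Houghton.HS (∑ i, Houghton.T V i) ∧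
      ((n = 2 ∨ Houghton.FSym (Houghton.X n) ≤ V) →
        Houghton.H (∑ i, Houghton.T V i) ≤ Houghton.refinedNormalizer V hT) ∧
      (∀ h ∈ Houghton.H (∑ i, Houghton.T V i),
        (∀ k t, Houghton.EventualTranslation h k t → Even t) →
          h ∈ Houghton.refinedNormalizer V hT) := by
  have hF : Houghton.FAlt (Houghton.X n) ≤ V :=
    Houghton.FAlt_le_of_finiteIndex Houghton.FSym_le_H hfin
  obtain ⟨p, hp, hs⟩ := Houghton.exists_shift_pow_mem hfin
  have hT : ∀ i, 0 < Houghton.T V i := fun i => (Houghton.T_spec hn hp hs i).1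
  have hu : ∀ i, ∃ u ∈ V, Houghton.EventualTranslation u i (Houghton.T V i) :=
    fun i => (Houghton.T_spec hn hp hs i).2
  refine ⟨⟨4 * p, by omega, ?_, Houghton.normalizer_le_normalizer_U hV hT hu hp hs,
    Houghton.U_characteristic hV hT hu hF hp hs⟩, hT,
    Houghton.refinedNormalizer_le_HS hV hT hu, ?_, ?_⟩
  · refine (Subgroup.closure_le _).2 ?_
    rintro _ (h | ⟨i, hi, rfl⟩)
    · exact hF h
    · rw [mul_comm, pow_mul]
      exact V.pow_mem (hs 0 i hi) 4
  · rintro (h | h)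
    · exact Houghton.H_le_refinedNormalizer_of_two hV hT hu h hF
    · exact Houghton.H_le_refinedNormalizer_of_FSym_le hV hT hu h
  · intro h hh he
    refine Houghton.mem_refinedNormalizer_of_even hV hT hu hF hh fun u _ => ?_
    exact Finset.even_sum _ fun k _ =>
      (he k _ (Houghton.eventualTranslation_trans hh k)).mul_right _
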